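/- Let $\mathsf A$ be an abelian category; subcategories are full and closed under isomorphisms. For a subcategory $\mathsf U$ put $\mathsf U^{\perp}=\{N : \operatorname{Ext}^1_{\mathsf A}(U,N)=0 \text{ for all } U\in\mathsf U\}$ and ${}^{\perp}\mathsf U=\{M : \operatorname{Ext}^1_{\mathsf A}(M,U)=0 \text{ for all } U\in\mathsf U\}$; a pair $(\mathsf U,\mathsf V)$ is a cotorsion pair if $\mathsf U^\perp=\mathsf V$ and ${}^\perp\mathsf V=\mathsf U$. A complex $T$ (with homological indexing, and cycle objects $\mathrm Z_i(T)$) is $\mathsf W$-totally acyclic, for a self-orthogonal subcategory $\mathsf W$ (that is, $\operatorname{Ext}^1_{\mathsf A}(W,W')=0$ for all $W,W'\in\mathsf W$), if $T$ is acyclic, $T_i\in\mathsf W$ and $\mathrm Z_i(T)\in\mathsf W^\perp$ for all $i\in\mathbb Z$, and $\operatorname{hom}_{\mathsf A}(T,W)$ is acyclic for every $W\in\mathsf W\cap\mathsf W^\perp$ $(=\mathsf W)$. An object is $\mathsf W$-Gorenstein if it is isomorphic to $\mathrm Z_0(T)$ for a $\mathsf W$-totally acyclic complex $T$; let $\mathsf{Gor}_{\mathsf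 W}(\mathsf A)$ be the full subcategory of these objects, and let $\mathsf K_{\mathrm{tac}}(\mathsf W)$ be the full subcategory of the homotopy category $\mathsf K(\mathsf A)$ whose objects are the $\mathsf W$-totally acyclic complexes. **Corollary.** (1) Let $(\mathsf U,\mathsf V)$ be a cotorsion pair in $\mathsf A$ and put $\mathsf W=\mathsf U\cap\mathsf V$ (a self-orthogonal subcategory). Then $\mathsf{Gor}_{\mathsf W}(\mathsf A)$ is closed under extensions and, with the induced exact structure, is a Frobenius category. Its stable category $\underline{\mathsf{Gor}}_{\mathsf W}(\mathsf A)$ (same objects, morphisms modulo those that factor through a projective-injective object of $\mathsf{Gor}_{\mathsf W}(\mathsf A)$) carries the usual triangulated structure: the suspension of $X$ is $C$ for a short exact sequence $0\to X\to I\to C\to 0$ in $\mathsf{Gor}_{\mathsf W}(\mathsf A)$ with $I$ projective-injective, and the distinguished triangles are, up to isomorphism, those induced by short exact sequences in $\mathsf{Gor}_{\mathsf W}(\mathsf A)$. Moreover $\mathsf K_{\mathrm{tac}}(\mathsf W)$ is a triangulated subcategory of $\mathsf K(\mathsf A)$. There is a biadjoint triangulated equivalence $$\mathrm T:\ \underline{\mathsf{Gor}}_{\mathsf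 W}(\mathsf A)\ \rightleftarrows\ \mathsf K_{\mathrm{tac}}(\mathsf W)\ :\mathrm Z_0 .$$ Here $\mathrm Z_0$ is the functor induced by $T\mapsto \mathrm Z_0(T)$, and $\mathrm T$ is the functor defined by any choice, for every $\mathsf W$-Gorenstein object $M$, of a $\mathsf W$-totally acyclic complex $\mathrm T(M)$ with $\mathrm Z_0(\mathrm T(M))\cong M$; it sends the class of $f\colon M\to M'$ to the homotopy class of any morphism of complexes $\mathrm T(M)\to \mathrm T(M')$ that induces $f$ on $\mathrm Z_0$. That is, both functors are triangulated and are equivalences, $\mathrm T$ is both left and right adjoint to $\mathrm Z_0$, and the adjunctions are compatible with the suspensions. (2) Let $\mathsf{Inj}(\mathsf A)$ and $\mathsf{Prj}(\mathsf A)$ be the subcategories of injective and of projective objects. The pair $(\mathsf A,\mathsf{Inj}(\mathsf A))$ is a cotorsion pair. Its $(\mathsf A\cap\mathsf{Inj}(\mathsf A))$-totally acyclic complexes are exactly the totally acyclic complexes of injective objects (acyclic complexes $T$ of injective objects with $\operatorname{hom}_{\mathsf A}(I,T)$ acyclic for all injective $I$), and its $(\mathsf A\cap\mathsf{Inj}(\mathsf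 A))$-Gorenstein objects are exactly the Gorenstein injective objects (those isomorphic to $\mathrm Z_0(T)$ for such a $T$). Likewise $(\mathsf{Prj}(\mathsf A),\mathsf A)$ is a cotorsion pair, its $(\mathsf{Prj}(\mathsf A)\cap\mathsf A)$-totally acyclic complexes are exactly the totally acyclic complexes of projective objects (acyclic complexes $T$ of projective objects with $\operatorname{hom}_{\mathsf A}(T,P)$ acyclic for all projective $P$), and its $(\mathsf{Prj}(\mathsf A)\cap\mathsf A)$-Gorenstein objects are exactly the Gorenstein projective objects (those isomorphic to $\mathrm Z_0(T)$ for such a $T$). Thus (1) contains the classical equivalences for Gorenstein injective and Gorenstein projective objects. -/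

import Mathlib

open CategoryTheory Limits ZeroObject Pretriangulated

universe w v u

namespace GorensteinStable

section Perp

variable {A : Type u} [Category.{v} A] [Abelian A]

lemma isClosedUnderBinaryProducts_of_biprod (P : ObjectProperty A) [P.IsClosedUnderIsomorphisms]
    (h : ∀ X Y, P X → P Y → P (X ⊞ Y)) : P.IsClosedUnderBinaryProducts where
  limitsOfShape_le := by
    rintro X ⟨p⟩
    have e : p.diag.obj ⟨WalkingPair.left⟩ ⊞ p.diag.obj ⟨WalkingPair.right⟩ ≅ X :=
      IsLimit.conePointsIsoOfNatIso (BinaryBiproduct.isLimit _ _) p.isLimit (diagramIsoPair _).symm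
    exact P.prop_of_iso e (h _ _ (p.prop_diag_obj _) (p.prop_diag_obj _))

variable [HasExt.{w} A]

/-- `U^⊥ = {N | Ext¹(M, N) = 0 for all M in U}`. -/
def rightPerp (U : ObjectProperty A) : ObjectProperty A :=
  fun N => ∀ M, U M → Subsingleton (Abelian.Ext.{w} M N 1)

/-- `^⊥V = {M | Ext¹(M, N) = 0 for all N in V}`. -/
def leftPerp (V : ObjectProperty A) : ObjectProperty A :=
  fun M => ∀ N, V N → Subsingleton (Abelian.Ext.{w} M N 1)

/-- `(U, V)` is a cotorsion pair: `U^⊥ = V` and `^⊥V = U`. -/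
class IsCotorsionPair (U V : ObjectProperty A) : Prop where
  rightPerp_eq : rightPerp.{w} U = V
  leftPerp_eq : leftPerp.{w} V = U

/-- `W` is self-orthogonal: `Ext¹(M, N) = 0` for all `M, N` in `W`. -/
class IsSelfOrthogonal (W : ObjectProperty A) : Prop where
  subsingleton_ext : ∀ M N, W M → W N → Subsingleton (Abelian.Ext.{w} M N 1)

lemma subsingleton_ext_of_retract_right {M N N' : A} (i : N' ⟶ N) (r : N ⟶ N')
    (h : i ≫ r = 𝟙 N') [Subsingleton (Abelian.Ext.{w} M N 1)] :
    Subsingleton (Abelian.Ext.{w} M N' 1) := by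
  refine subsingleton_of_forall_eq 0 fun x => ?_
  have e : (x.comp (Abelian.Ext.mk₀ i) (add_zero 1)).comp (Abelian.Ext.mk₀ r) (add_zero 1) = x := by
    simp [Abelian.Ext.comp_assoc_of_second_deg_zero, h]
  rw [← e, Subsingleton.elim (x.comp (Abelian.Ext.mk₀ i) (add_zero 1)) 0, Abelian.Ext.zero_comp]

lemma subsingleton_ext_of_retract_left {M M' N : A} (i : M' ⟶ M) (r : M ⟶ M')
    (h : i ≫ r = 𝟙 M') [Subsingleton (Abelian.Ext.{w} M N 1)] :
    Subsingleton (Abelian.Ext.{w} M' N 1) := by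
  refine subsingleton_of_forall_eq 0 fun x => ?_
  have e : (Abelian.Ext.mk₀ i).comp ((Abelian.Ext.mk₀ r).comp x (zero_add 1)) (zero_add 1) = x := by
    rw [← Abelian.Ext.comp_assoc_of_second_deg_zero]
    simp [h]
  rw [← e, Subsingleton.elim ((Abelian.Ext.mk₀ r).comp x (zero_add 1)) 0, Abelian.Ext.comp_zero]

lemma exists_lift_of_ext {S : ShortComplex A} (hS : S.ShortExact) {P : A}
    (h : Subsingleton (Abelian.Ext.{w} P S.X₁ 1)) (f : P ⟶ S.X₃) : ∃ g : P ⟶ S.X₂, g ≫ S.g = f := by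
  obtain ⟨x, hx⟩ := Abelian.Ext.covariant_sequence_exact₃ P hS
    (Abelian.Ext.mk₀ f) (zero_add 1) (Subsingleton.elim _ _)
  refine ⟨Abelian.Ext.homEquiv₀ x, (Abelian.Ext.mk₀_bijective _ _).1 ?_⟩
  rw [← hx, ← Abelian.Ext.mk₀_comp_mk₀, Abelian.Ext.mk₀_homEquiv₀_apply]

lemma exists_extension_of_ext {S : ShortComplex A} (hS : S.ShortExact) {I : A}
    (h : Subsingleton (Abelian.Ext.{w} S.X₃ I 1)) (f : S.X₁ ⟶ I) :
    ∃ g : S.X₂ ⟶ I, S.f ≫ g = f := by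
  obtain ⟨x, hx⟩ := Abelian.Ext.contravariant_sequence_exact₁ hS I
    (Abelian.Ext.mk₀ f) (add_zero 1) (Subsingleton.elim _ _)
  refine ⟨Abelian.Ext.homEquiv₀ x, (Abelian.Ext.mk₀_bijective _ _).1 ?_⟩
  rw [← hx, ← Abelian.Ext.mk₀_comp_mk₀, Abelian.Ext.mk₀_homEquiv₀_apply]

lemma subsingleton_ext_biprod_right {M N N' : A} [Subsingleton (Abelian.Ext.{w} M N 1)]
    [Subsingleton (Abelian.Ext.{w} M N' 1)] : Subsingleton (Abelian.Ext.{w} M (N ⊞ N') 1) := by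
  refine subsingleton_of_forall_eq 0 fun x => ?_
  have e : x.comp (Abelian.Ext.mk₀ (biprod.fst ≫ biprod.inl + biprod.snd ≫ biprod.inr))
      (add_zero 1) = x := by
    rw [biprod.total]; simp
  rw [← e, Abelian.Ext.mk₀_add, Abelian.Ext.comp_add, ← Abelian.Ext.mk₀_comp_mk₀,
    ← Abelian.Ext.mk₀_comp_mk₀, ← Abelian.Ext.comp_assoc_of_second_deg_zero,
    ← Abelian.Ext.comp_assoc_of_second_deg_zero,
    Subsingleton.elim (x.comp (Abelian.Ext.mk₀ (biprod.fst : N ⊞ N' ⟶ N)) (add_zero 1)) 0,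
    Subsingleton.elim (x.comp (Abelian.Ext.mk₀ (biprod.snd : N ⊞ N' ⟶ N')) (add_zero 1)) 0,
    Abelian.Ext.zero_comp, Abelian.Ext.zero_comp, add_zero]

lemma subsingleton_ext_biprod_left {M M' N : A} [Subsingleton (Abelian.Ext.{w} M N 1)]
    [Subsingleton (Abelian.Ext.{w} M' N 1)] : Subsingleton (Abelian.Ext.{w} (M ⊞ M') N 1) := by
  refine subsingleton_of_forall_eq 0 fun x => ?_
  have e : (Abelian.Ext.mk₀ (biprod.fst ≫ biprod.inl + biprod.snd ≫ biprod.inr)).comp x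
      (zero_add 1) = x := by
    rw [biprod.total]; simp
  rw [← e, Abelian.Ext.mk₀_add, Abelian.Ext.add_comp, ← Abelian.Ext.mk₀_comp_mk₀,
    ← Abelian.Ext.mk₀_comp_mk₀, Abelian.Ext.comp_assoc_of_second_deg_zero,
    Abelian.Ext.comp_assoc_of_second_deg_zero,
    Subsingleton.elim ((Abelian.Ext.mk₀ (biprod.inl : M ⟶ M ⊞ M')).comp x (zero_add 1)) 0,
    Subsingleton.elim ((Abelian.Ext.mk₀ (biprod.inr : M' ⟶ M ⊞ M')).comp x (zero_add 1)) 0,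
    Abelian.Ext.comp_zero, Abelian.Ext.comp_zero, add_zero]

lemma subsingleton_ext_of_isZero {M N : A} (h : IsZero M ∨ IsZero N) :
    Subsingleton (Abelian.Ext.{w} M N 1) := by
  refine subsingleton_of_forall_eq 0 fun x => ?_
  rcases h with h | h
  · rw [← Abelian.Ext.mk₀_id_comp x, h.eq_of_src (𝟙 M) 0, Abelian.Ext.mk₀_zero,
      Abelian.Ext.zero_comp]
  · rw [← Abelian.Ext.comp_mk₀_id x, h.eq_of_src (𝟙 N) 0, Abelian.Ext.mk₀_zero,
      Abelian.Ext.comp_zero]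

instance (U : ObjectProperty A) : (rightPerp.{w} U).IsClosedUnderIsomorphisms where
  of_iso e h M hM := by
    have := h M hM
    exact subsingleton_ext_of_retract_right e.inv e.hom e.inv_hom_id

instance (V : ObjectProperty A) : (leftPerp.{w} V).IsClosedUnderIsomorphisms where
  of_iso e h M hM := by
    have := h M hM
    exact subsingleton_ext_of_retract_left e.inv e.hom e.inv_hom_id

section CotorsionPair

lemma IsCotorsionPair.subsingleton_ext (U V : ObjectProperty A) [h : IsCotorsionPair.{w} U V] {M N : A}
    (hM : U M) (hN : V N) :
    Subsingleton (Abelian.Ext.{w} M N 1) := by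
  rw [← h.rightPerp_eq] at hN
  exact hN M hM

instance isSelfOrthogonal_inf (U V : ObjectProperty A) [h : IsCotorsionPair.{w} U V] :
    IsSelfOrthogonal.{w} (U ⊓ V) where
  subsingleton_ext _ _ hM hN := IsCotorsionPair.subsingleton_ext U V hM.1 hN.2

lemma IsCotorsionPair.inf_eq (U V : ObjectProperty A) [h : IsCotorsionPair.{w} U V] :
    U ⊓ V = leftPerp.{w} V ⊓ rightPerp.{w} U := by
  rw [h.rightPerp_eq, h.leftPerp_eq]

instance containsZero_inf (U V : ObjectProperty A) [h : IsCotorsionPair.{w} U V] :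
    (U ⊓ V).ContainsZero where
  exists_zero := by
    refine ⟨0, isZero_zero A, ?_⟩
    rw [IsCotorsionPair.inf_eq.{w} U V]
    exact ⟨fun _ _ => subsingleton_ext_of_isZero (Or.inl (isZero_zero A)),
      fun _ _ => subsingleton_ext_of_isZero (Or.inr (isZero_zero A))⟩

instance isClosedUnderIsomorphisms_inf (U V : ObjectProperty A) [h : IsCotorsionPair.{w} U V] :
    (U ⊓ V).IsClosedUnderIsomorphisms := by
  rw [IsCotorsionPair.inf_eq.{w} U V]
  infer_instance

instance isClosedUnderBinaryProducts_inf (U V : ObjectProperty A) [h : IsCotorsionPair.{w} U V] :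
    (U ⊓ V).IsClosedUnderBinaryProducts := by
  have := isClosedUnderIsomorphisms_inf.{w} U V
  refine isClosedUnderBinaryProducts_of_biprod _ fun X Y hX hY => ?_
  rw [IsCotorsionPair.inf_eq.{w} U V] at hX hY ⊢
  refine ⟨fun N hN => ?_, fun M hM => ?_⟩
  · have := hX.1 N hN
    have := hY.1 N hN
    exact subsingleton_ext_biprod_left
  · have := hX.2 M hM
    have := hY.2 M hM
    exact subsingleton_ext_biprod_right

end CotorsionPair

end Perp


section Complexes

variable {A : Type u} [Category.{v} A] [Abelian A]

/-- The complex of abelian groups `Hom(T, M)` is acyclic. -/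
def HomToAcyclic (T : CochainComplex A ℤ) (M : A) : Prop :=
  (((preadditiveYoneda.obj M).mapHomologicalComplex _).obj T.op).Acyclic

/-- The complex of abelian groups `Hom(M, T)` is acyclic. -/
def HomFromAcyclic (M : A) (T : CochainComplex A ℤ) : Prop :=
  (((preadditiveCoyoneda.obj (Opposite.op M)).mapHomologicalComplex _).obj T).Acyclic

lemma homToAcyclic_iff (T : CochainComplex A ℤ) (M : A) :
    HomToAcyclic T M ↔ ∀ (i j k : ℤ), i + 1 = j → j + 1 = k → ∀ f : T.X j ⟶ M,
      T.d i j ≫ f = 0 → ∃ g : T.X k ⟶ M, T.d j k ≫ g = f := by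
  have key : ∀ (i j k : ℤ) (hi : i + 1 = j) (hk : j + 1 = k),
      (((preadditiveYoneda.obj M).mapHomologicalComplex _).obj T.op).ExactAt j ↔
      ∀ f : T.X j ⟶ M, T.d i j ≫ f = 0 → ∃ g : T.X k ⟶ M, T.d j k ≫ g = f := by
    intro i j k hi hk
    rw [HomologicalComplex.exactAt_iff' _ k j i
      (ComplexShape.prev_eq' _ (show (ComplexShape.up ℤ).symm.Rel k j from hk))
      (ComplexShape.next_eq' _ (show (ComplexShape.up ℤ).symm.Rel j i from hi)),
      ShortComplex.ab_exact_iff]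
    rfl
  constructor
  · intro h i j k hi hk
    exact (key i j k hi hk).1 (h j)
  · intro h j
    exact (key (j - 1) j (j + 1) (by lia) rfl).2 (h _ _ _ (by lia) rfl)

/-- An acyclic complex gives short exact sequences `0 ⟶ Z^i ⟶ T^i ⟶ Z^j ⟶ 0` for `j = i + 1`. -/
lemma shortExact_cycles {T : CochainComplex A ℤ} (hT : T.Acyclic) (i j : ℤ) (hij : i + 1 = j) :
    (ShortComplex.mk (T.iCycles i) (T.toCycles i j) (by
      rw [← cancel_mono (T.iCycles j), Category.assoc, T.toCycles_i, zero_comp,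
        T.iCycles_d])).ShortExact where
  mono_f := inferInstanceAs (Mono (T.iCycles i))
  epi_g := by
    have h := (hT j)
    rw [HomologicalComplex.exactAt_iff, ShortComplex.exact_iff_epi_toCycles] at h
    obtain rfl : i = (ComplexShape.up ℤ).prev j := by simp [← hij]
    exact h
  exact := by
    apply ShortComplex.exact_of_f_is_kernel
    refine KernelFork.IsLimit.ofι' _ _ fun {B} (k : B ⟶ T.X i) (hk : k ≫ T.toCycles i j = 0) => ?_
    have hk' : k ≫ T.d i j = 0 := by rw [← T.toCycles_i, reassoc_of% hk, zero_comp]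
    exact ⟨T.liftCycles k j (by simp [hij]) hk', T.liftCycles_i k j _ hk'⟩

/-- A right `W`-totally acyclic complex. Cohomological indexing is used: the object in homological
degree `i` is `T.X (-i)`. For a self-orthogonal `W` these are the right, equivalently left,
`W`-totally acyclic complexes, called `W`-totally acyclic complexes. -/
structure IsTotallyAcyclic [HasExt.{w} A] (W : ObjectProperty A) (T : CochainComplex A ℤ) :
    Prop where
  acyclic : T.Acyclic
  prop_X : ∀ i, W (T.X i)
  prop_cycles : ∀ i, rightPerp.{w} W (T.cycles i)
  hom_acyclic : ∀ M, W M → rightPerp.{w} W M → HomToAcyclic T M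

variable [HasExt.{w} A] (W : ObjectProperty A)

/-- The `W`-totally acyclic complexes, as a full subcategory of complexes. -/
def totallyAcyclic : ObjectProperty (CochainComplex A ℤ) :=
  fun T => IsTotallyAcyclic.{w} W T

/-- The homotopy category of `W`-totally acyclic complexes, as a full subcategory of the homotopy
category of all complexes. -/
def homotopyTotallyAcyclic : ObjectProperty (HomotopyCategory A (ComplexShape.up ℤ)) :=
  fun K => IsTotallyAcyclic.{w} W K.as

/-- The `W`-Gorenstein objects: the degree zero cycles of `W`-totally acyclic complexes. -/
def gorenstein : ObjectProperty A :=
  fun M => ∃ T : CochainComplex A ℤ, IsTotallyAcyclic.{w} W T ∧ Nonempty (T.cycles 0 ≅ M)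

instance : (gorenstein.{w} W).IsClosedUnderIsomorphisms where
  of_iso := by
    rintro X Y e ⟨T, hT, ⟨e'⟩⟩
    exact ⟨T, hT, ⟨e' ≪≫ e⟩⟩

variable {W}

lemma isTotallyAcyclic_of_contraction [IsSelfOrthogonal.{w} W] (T : CochainComplex A ℤ)
    (hX : ∀ i, W (T.X i))
    (hT : ∀ i j k : ℤ, i + 1 = j → j + 1 = k → ∃ (s : T.X j ⟶ T.X i) (t : T.X k ⟶ T.X j),
      s ≫ T.d i j + T.d j k ≫ t = 𝟙 (T.X j)) : IsTotallyAcyclic.{w} W T where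
  acyclic j := by
    obtain ⟨i, hi⟩ : ∃ i : ℤ, i = (ComplexShape.up ℤ).prev j := ⟨_, rfl⟩
    have hi' : i + 1 = j := by simp [hi]
    obtain ⟨s, t, h⟩ := hT i j (j + 1) hi' rfl
    have hS : (T.iCycles j ≫ s) ≫ T.toCycles i j = 𝟙 _ := by
      rw [← cancel_mono (T.iCycles j), Category.assoc, Category.assoc, T.toCycles_i,
        Category.id_comp]
      have h₁ := T.iCycles j ≫= h
      rwa [Preadditive.comp_add, T.iCycles_d_assoc, zero_comp, add_zero, Category.comp_id] at h₁
    have : IsSplitEpi (T.toCycles i j) := ⟨⟨⟨_, hS⟩⟩⟩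
    rw [HomologicalComplex.exactAt_iff, ShortComplex.exact_iff_epi_toCycles]
    subst hi
    exact inferInstanceAs (Epi (T.toCycles _ j))
  prop_X := hX
  prop_cycles j M hM := by
    obtain ⟨s, t, h⟩ := hT (j - 1) j (j + 1) (by lia) rfl
    have := IsSelfOrthogonal.subsingleton_ext.{w} _ _ hM (hX (j - 1))
    refine subsingleton_ext_of_retract_right (T.iCycles j ≫ s) (T.toCycles (j - 1) j) ?_
    rw [← cancel_mono (T.iCycles j), Category.assoc, Category.assoc, T.toCycles_i, Category.id_comp]
    have h₁ := T.iCycles j ≫= h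
    rwa [Preadditive.comp_add, T.iCycles_d_assoc, zero_comp, add_zero, Category.comp_id] at h₁
  hom_acyclic M _ _ := by
    rw [homToAcyclic_iff]
    intro i j k hi hk f hf
    obtain ⟨s, t, h⟩ := hT i j k hi hk
    refine ⟨t ≫ f, ?_⟩
    have := h =≫ f
    rwa [Preadditive.add_comp, Category.assoc, hf, comp_zero, zero_add, Category.assoc,
      Category.id_comp] at this

instance containsZero_gorenstein [IsSelfOrthogonal.{w} W] [W.ContainsZero]
    [W.IsClosedUnderIsomorphisms] : (gorenstein.{w} W).ContainsZero where
  exists_zero := by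
    have hX : ∀ i, IsZero ((0 : CochainComplex A ℤ).X i) := fun i =>
      (HomologicalComplex.eval A _ i).map_isZero (isZero_zero _)
    refine ⟨_, (HomologicalComplex.cyclesFunctor A _ 0).map_isZero (isZero_zero _), 0,
      isTotallyAcyclic_of_contraction _ (fun i => W.prop_of_isZero (hX i)) ?_, ⟨Iso.refl _⟩⟩
    intro i j k _ _
    exact ⟨0, 0, (hX j).eq_of_src _ _⟩

lemma gorenstein_of_prop [IsSelfOrthogonal.{w} W] [W.ContainsZero]
    [W.IsClosedUnderIsomorphisms] {M : A} (hM : W M) : gorenstein.{w} W M := by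
  have hr : (ComplexShape.up ℤ).Rel (-1) 0 := by simp
  let T : CochainComplex A ℤ := HomologicalComplex.double (𝟙 M) hr
  let e₀ : T.X (-1) ≅ M := HomologicalComplex.doubleXIso₀ (𝟙 M) hr
  let e₁ : T.X 0 ≅ M := HomologicalComplex.doubleXIso₁ (𝟙 M) hr (by decide)
  have hd : T.d (-1) 0 = e₀.hom ≫ e₁.inv := by
    simpa using HomologicalComplex.double_d (𝟙 M) hr (by decide)
  have hz : ∀ i, i ≠ -1 → i ≠ 0 → IsZero (T.X i) := fun i h₀ h₁ =>
    HomologicalComplex.isZero_double_X (𝟙 M) hr i h₀ h₁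
  refine ⟨T, isTotallyAcyclic_of_contraction T (fun i => ?_) ?_, ⟨?_⟩⟩
  · by_cases h₀ : i = -1
    · subst h₀
      exact W.prop_of_iso e₀.symm hM
    · by_cases h₁ : i = 0
      · subst h₁
        exact W.prop_of_iso e₁.symm hM
      · exact W.prop_of_isZero (hz i h₀ h₁)
  · intro i j k hi hk
    by_cases h₀ : j = -1
    · subst h₀
      obtain rfl : k = 0 := by lia
      exact ⟨0, e₁.hom ≫ e₀.inv, by simp [hd]⟩
    · by_cases h₁ : j = 0
      · subst h₁
        obtain rfl : i = -1 := by lia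
        exact ⟨e₁.hom ≫ e₀.inv, 0, by simp [hd]⟩
      · exact ⟨0, 0, (hz j h₀ h₁).eq_of_src _ _⟩
  · exact T.iCyclesIso 0 1 (by simp) ((hz 1 (by decide) (by decide)).eq_of_tgt _ _) ≪≫ e₁

instance (i : ℤ) : (HomologicalComplex.cyclesFunctor A (ComplexShape.up ℤ) i).Additive where
  map_add {X Y f g} := by
    change HomologicalComplex.cyclesMap (f + g) i =
      HomologicalComplex.cyclesMap f i + HomologicalComplex.cyclesMap g i
    rw [← cancel_mono (Y.iCycles i)]
    simp

lemma isTotallyAcyclic_biprod [W.IsClosedUnderBinaryProducts] [W.IsClosedUnderIsomorphisms]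
    {T T' : CochainComplex A ℤ} (hT : IsTotallyAcyclic.{w} W T) (hT' : IsTotallyAcyclic.{w} W T') :
    IsTotallyAcyclic.{w} W (T ⊞ T') where
  acyclic i := by
    have := preservesBinaryBiproducts_of_preservesBiproducts
      (HomologicalComplex.homologyFunctor A (ComplexShape.up ℤ) i)
    rw [HomologicalComplex.exactAt_iff_isZero_homology]
    refine IsZero.of_iso ?_
      ((HomologicalComplex.homologyFunctor A (ComplexShape.up ℤ) i).mapBiprod T T')
    rw [biprod_isZero_iff]
    exact ⟨(hT.acyclic i).isZero_homology, (hT'.acyclic i).isZero_homology⟩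
  prop_X i := W.prop_of_iso ((HomologicalComplex.biprodXIso T T' i) ≪≫ biprod.isoProd _ _).symm
    (W.prop_prod _ _ (hT.prop_X i) (hT'.prop_X i))
  prop_cycles i := by
    have := preservesBinaryBiproducts_of_preservesBiproducts
      (HomologicalComplex.cyclesFunctor A (ComplexShape.up ℤ) i)
    refine (rightPerp.{w} W).prop_of_iso
      ((HomologicalComplex.cyclesFunctor A (ComplexShape.up ℤ) i).mapBiprod T T').symm ?_
    intro M hM
    have : Subsingleton (Abelian.Ext.{w} M
      ((HomologicalComplex.cyclesFunctor A (ComplexShape.up ℤ) i).obj T) 1) :=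
        hT.prop_cycles i M hM
    have : Subsingleton (Abelian.Ext.{w} M
      ((HomologicalComplex.cyclesFunctor A (ComplexShape.up ℤ) i).obj T') 1) :=
        hT'.prop_cycles i M hM
    exact subsingleton_ext_biprod_right
  hom_acyclic M hM hM' := by
    have h₁ := hT.hom_acyclic M hM hM'
    have h₂ := hT'.hom_acyclic M hM hM'
    rw [homToAcyclic_iff] at h₁ h₂ ⊢
    intro i j k hi hk f hf
    obtain ⟨g, hg⟩ := h₁ i j k hi hk ((biprod.inl : T ⟶ T ⊞ T').f j ≫ f) (by
      rw [← HomologicalComplex.Hom.comm_assoc, hf, comp_zero])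
    obtain ⟨g', hg'⟩ := h₂ i j k hi hk ((biprod.inr : T' ⟶ T ⊞ T').f j ≫ f) (by
      rw [← HomologicalComplex.Hom.comm_assoc, hf, comp_zero])
    refine ⟨(biprod.fst : T ⊞ T' ⟶ T).f k ≫ g + (biprod.snd : T ⊞ T' ⟶ T').f k ≫ g', ?_⟩
    rw [Preadditive.comp_add, ← HomologicalComplex.Hom.comm_assoc,
      ← HomologicalComplex.Hom.comm_assoc, hg, hg', ← Category.assoc, ← Category.assoc,
      ← Preadditive.add_comp, HomologicalComplex.biprod_total_f, Category.id_comp]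

instance isClosedUnderBinaryProducts_gorenstein [W.IsClosedUnderBinaryProducts]
    [W.IsClosedUnderIsomorphisms] : (gorenstein.{w} W).IsClosedUnderBinaryProducts := by
  refine isClosedUnderBinaryProducts_of_biprod _ ?_
  rintro X Y ⟨T, hT, ⟨e⟩⟩ ⟨T', hT', ⟨e'⟩⟩
  have := preservesBinaryBiproducts_of_preservesBiproducts
    (HomologicalComplex.cyclesFunctor A (ComplexShape.up ℤ) 0)
  exact ⟨T ⊞ T', isTotallyAcyclic_biprod hT hT',
    ⟨(HomologicalComplex.cyclesFunctor A (ComplexShape.up ℤ) 0).mapBiprod T T' ≪≫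
      biprod.mapIso e e'⟩⟩

end Complexes

section StableCategory

variable {A : Type u} [Category.{v} A] [Abelian A] (G : ObjectProperty A)

variable {G} in
/-- The conflations of the full subcategory `G`: the short exact sequences of the ambient abelian
category whose three terms belong to `G`. -/
def IsConflation (S : ShortComplex G.FullSubcategory) : Prop :=
  (S.map G.ι).ShortExact

variable {G} in
/-- Projective objects of `G` relative to the conflations. -/
def IsRelProjective (P : G.FullSubcategory) : Prop :=
  ∀ S : ShortComplex G.FullSubcategory, IsConflation S →
    ∀ f : P ⟶ S.X₃, ∃ g : P ⟶ S.X₂, g ≫ S.g = f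

variable {G} in
/-- Injective objects of `G` relative to the conflations. -/
def IsRelInjective (I : G.FullSubcategory) : Prop :=
  ∀ S : ShortComplex G.FullSubcategory, IsConflation S →
    ∀ f : S.X₁ ⟶ I, ∃ g : S.X₂ ⟶ I, S.f ≫ g = f

/-- The full subcategory `G` is closed under extensions and, with the induced exact structure,
it is a Frobenius category. -/
structure IsFrobenius : Prop where
  isClosedUnderExtensions : G.IsClosedUnderExtensions
  enough_projectives : ∀ M : G.FullSubcategory, ∃ (K P : G.FullSubcategory) (i : K ⟶ P)
    (p : P ⟶ M) (w : i ≫ p = 0), IsConflation (ShortComplex.mk i p w) ∧ IsRelProjective P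
  enough_injectives : ∀ M : G.FullSubcategory, ∃ (I K : G.FullSubcategory) (i : M ⟶ I)
    (p : I ⟶ K) (w : i ≫ p = 0), IsConflation (ShortComplex.mk i p w) ∧ IsRelInjective I
  isRelProjective_iff : ∀ M : G.FullSubcategory, IsRelProjective M ↔ IsRelInjective M

/-- Two morphisms are identified in the stable category when their difference factors through a
projective-injective object. -/
def stableRel : HomRel G.FullSubcategory := fun X Y f g =>
  ∃ (P : G.FullSubcategory) (a : X ⟶ P) (b : P ⟶ Y),
    IsRelProjective P ∧ IsRelInjective P ∧ f - g = a ≫ b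

/-- The stable category of `G`. -/
abbrev StableCategory : Type _ := Quotient (stableRel G)

/-- The quotient functor from `G` to its stable category. -/
abbrev toStable : G.FullSubcategory ⥤ StableCategory G := Quotient.functor (stableRel G)

section Additive

instance [G.IsClosedUnderBinaryProducts] : HasBinaryBiproducts G.FullSubcategory :=
  HasBinaryBiproducts.of_hasBinaryProducts

variable {G} in
lemma stableRel_add [G.IsClosedUnderBinaryProducts] {X Y : G.FullSubcategory} {f₁ f₂ g₁ g₂ : X ⟶ Y} (h : stableRel G f₁ f₂)
    (h' : stableRel G g₁ g₂) : stableRel G (f₁ + g₁) (f₂ + g₂) := by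
  obtain ⟨P, a, b, hp, hi, e⟩ := h
  obtain ⟨P', a', b', hp', hi', e'⟩ := h'
  refine ⟨P ⊞ P', biprod.lift a a', biprod.desc b b', ?_, ?_, ?_⟩
  · intro S hS f
    obtain ⟨g, hg⟩ := hp S hS (biprod.inl ≫ f)
    obtain ⟨g', hg'⟩ := hp' S hS (biprod.inr ≫ f)
    exact ⟨biprod.desc g g', by apply biprod.hom_ext' <;> simp [hg, hg']⟩
  · intro S hS f
    obtain ⟨g, hg⟩ := hi S hS (f ≫ biprod.fst)
    obtain ⟨g', hg'⟩ := hi' S hS (f ≫ biprod.snd)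
    exact ⟨biprod.lift g g', by apply biprod.hom_ext <;> simp [hg, hg']⟩
  · rw [biprod.lift_desc, ← e, ← e']
    abel

variable [G.ContainsZero] [G.IsClosedUnderBinaryProducts]

instance : Congruence (stableRel G) where
  comp_left := by
    rintro X Y Z f g g' ⟨P, a, b, hp, hi, e⟩
    exact ⟨P, f ≫ a, b, hp, hi, by rw [Category.assoc, ← e, Preadditive.comp_sub]⟩
  comp_right := by
    rintro X Y Z f f' g ⟨P, a, b, hp, hi, e⟩
    exact ⟨P, a, b ≫ g, hp, hi, by rw [← Category.assoc, ← e, Preadditive.sub_comp]⟩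
  equivalence {X Y} :=
    { refl := fun f => ⟨0, 0, 0, fun S _ f => ⟨0, (isZero_zero _).eq_of_src _ _⟩,
        fun S _ f => ⟨0, (isZero_zero _).eq_of_tgt _ _⟩, by simp⟩
      symm := by
        rintro f g ⟨P, a, b, hp, hi, e⟩
        exact ⟨P, -a, b, hp, hi, by rw [Preadditive.neg_comp, ← e, neg_sub]⟩
      trans := by
        intro f g k h h'
        obtain ⟨P, a, b, hp, hi, e⟩ := stableRel_add h h'
        exact ⟨P, a, b, hp, hi, by rw [← e]; abel⟩ }

instance : Preadditive (StableCategory G) :=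
  Quotient.preadditive _ fun _ _ _ _ _ _ h h' => stableRel_add h h'

instance : (toStable G).Additive := Quotient.functor_additive _ _

instance : HasZeroObject (StableCategory G) :=
  ⟨_, (toStable G).map_isZero (isZero_zero G.FullSubcategory)⟩

/-- A pretriangulated structure on the stable category of a Frobenius category `G` is the usual one
when:
* the shift is the suspension: every conflation `X ⟶ I ⟶ C` with `I` projective-injective comes
  with an isomorphism between `C` and `X⟦1⟧`, and these isomorphisms are compatible with all
  morphisms between such conflations;
* the distinguished triangles are, up to isomorphism, the triangles `X ⟶ Y ⟶ Z ⟶ X⟦1⟧` coming from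
  conflations `X ⟶ Y ⟶ Z`: the last morphism is induced by any morphism of conflations, the
  identity on `X`, to a conflation `X ⟶ I ⟶ C` with `I` projective-injective. -/
structure StandardTriangulation [HasShift (StableCategory G) ℤ]
    [∀ n : ℤ, (shiftFunctor (StableCategory G) n).Additive] [Pretriangulated (StableCategory G)] where
  /-- The identification of `S.X₃` with the shift of `S.X₁`. -/
  suspIso (S : ShortComplex G.FullSubcategory) (hS : IsConflation S) (hp : IsRelProjective S.X₂)
    (hi : IsRelInjective S.X₂) :
    (toStable G).obj S.X₃ ≅ ((toStable G).obj S.X₁)⟦(1 : ℤ)⟧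
  suspIso_naturality (S S' : ShortComplex G.FullSubcategory) (hS : IsConflation S)
    (hp : IsRelProjective S.X₂) (hi : IsRelInjective S.X₂) (hS' : IsConflation S')
    (hp' : IsRelProjective S'.X₂) (hi' : IsRelInjective S'.X₂) (φ : S ⟶ S') :
    (toStable G).map φ.τ₃ ≫ (suspIso S' hS' hp' hi').hom =
      (suspIso S hS hp hi).hom ≫ ((toStable G).map φ.τ₁)⟦(1 : ℤ)⟧'
  distinguished_iff (T : Triangle (StableCategory G)) :
    T ∈ distTriang (StableCategory G) ↔
      ∃ (X Y Z I C : G.FullSubcategory) (f : X ⟶ Y) (g : Y ⟶ Z) (i : X ⟶ I) (p : I ⟶ C)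
        (w : f ≫ g = 0) (w' : i ≫ p = 0) (j : Y ⟶ I) (k : Z ⟶ C)
        (_ : IsConflation (ShortComplex.mk f g w))
        (h : IsConflation (ShortComplex.mk i p w')) (hp : IsRelProjective I)
        (hi : IsRelInjective I), f ≫ j = i ∧ g ≫ k = j ≫ p ∧
        Nonempty (T ≅ Triangle.mk ((toStable G).map f) ((toStable G).map g)
          ((toStable G).map k ≫ (suspIso (ShortComplex.mk i p w') h hp hi).hom))

end Additive

end StableCategory

section CyclesFunctor

variable {A : Type u} [Category.{v} A] [Abelian A] [HasExt.{w} A] (W : ObjectProperty A)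

/-- The `W`-Gorenstein objects, as a category. -/
abbrev Gor : Type _ := (gorenstein.{w} W).FullSubcategory

/-- The category of `W`-totally acyclic complexes. -/
abbrev Tac : Type _ := (totallyAcyclic.{w} W).FullSubcategory

/-- The stable category of `W`-Gorenstein objects. -/
abbrev StGor : Type _ := StableCategory (gorenstein.{w} W)

/-- The homotopy category of `W`-totally acyclic complexes. -/
abbrev KTac : Type _ := (homotopyTotallyAcyclic.{w} W).FullSubcategory

/-- The functor sending a totally acyclic complex to its cycles in degree zero. -/
noncomputable def cyclesZero : Tac.{w} W ⥤ Gor.{w} W :=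
  ObjectProperty.lift _ ((totallyAcyclic.{w} W).ι ⋙ HomologicalComplex.cyclesFunctor A _ 0)
    fun T => ⟨T.obj, T.property, ⟨Iso.refl _⟩⟩

/-- The quotient functor from totally acyclic complexes to their homotopy category. -/
def toKTac : Tac.{w} W ⥤ KTac.{w} W :=
  ObjectProperty.lift _ ((totallyAcyclic.{w} W).ι ⋙ HomotopyCategory.quotient A _)
    fun T => T.property

variable {W}

lemma isRelProjective_of_prop (P : Gor.{w} W) (hP : W P.obj) : IsRelProjective P := by
  intro S hS f
  obtain ⟨T, hT, ⟨e⟩⟩ := S.X₁.property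
  have h₁ : Subsingleton (Abelian.Ext.{w} P.obj S.X₁.obj 1) :=
    (rightPerp.{w} W).prop_of_iso e (hT.prop_cycles 0) _ hP
  obtain ⟨g, hg⟩ := exists_lift_of_ext hS h₁ f.hom
  exact ⟨ObjectProperty.homMk g, by ext; exact hg⟩

variable [IsSelfOrthogonal.{w} W]

lemma IsTotallyAcyclic.subsingleton_ext {T : CochainComplex A ℤ} (hT : IsTotallyAcyclic.{w} W T)
    {M : A} (hM : W M) : Subsingleton (Abelian.Ext.{w} (T.cycles 0) M 1) := by
  refine subsingleton_of_forall_eq 0 fun x => ?_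
  have hS := shortExact_cycles hT.acyclic (-1) 0 (by simp)
  have h₁ := IsSelfOrthogonal.subsingleton_ext.{w} _ _ (hT.prop_X (-1)) hM
  obtain ⟨y, rfl⟩ := Abelian.Ext.contravariant_sequence_exact₃ hS M x
    (Subsingleton.elim (α := Abelian.Ext (T.X (-1)) M 1) _ _) (add_zero 1)
  obtain ⟨u, rfl⟩ : ∃ u, y = Abelian.Ext.mk₀ u := ⟨_, (Abelian.Ext.mk₀_homEquiv₀_apply y).symm⟩
  obtain ⟨g, hg⟩ := (homToAcyclic_iff T M).1 (hT.hom_acyclic M hM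
    (fun N hN => IsSelfOrthogonal.subsingleton_ext.{w} _ _ hN hM)) (-3) (-2) (-1)
    (by simp) (by simp) (T.toCycles (-2) (-1) ≫ u) (by simp)
  have := (shortExact_cycles hT.acyclic (-2) (-1) (by simp)).epi_g
  dsimp at this
  have hu : u = T.iCycles (-1) ≫ g := by
    rw [← cancel_epi (T.toCycles (-2) (-1)), ← hg, ← Category.assoc, T.toCycles_i]
  have : Abelian.Ext.mk₀ u = (Abelian.Ext.mk₀ (T.iCycles (-1))).comp (Abelian.Ext.mk₀ g)
      (zero_add 0) := by rw [hu, Abelian.Ext.mk₀_comp_mk₀]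
  rw [this]
  exact hS.extClass_comp_assoc _

lemma isRelInjective_of_prop (I : Gor.{w} W) (hI : W I.obj) : IsRelInjective I := by
  intro S hS f
  obtain ⟨T, hT, ⟨e⟩⟩ := S.X₃.property
  have h₁ := hT.subsingleton_ext hI
  have h₂ : Subsingleton (Abelian.Ext.{w} S.X₃.obj I.obj 1) :=
    subsingleton_ext_of_retract_left e.inv e.hom e.inv_hom_id
  obtain ⟨g, hg⟩ := exists_extension_of_ext hS h₂ f.hom
  exact ⟨ObjectProperty.homMk g, by ext; exact hg⟩

variable [W.ContainsZero] [W.IsClosedUnderIsomorphisms]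

lemma stableRel_of_homotopy {T T' : Tac.{w} W} {φ ψ : T ⟶ T'} (h : Homotopy φ.hom ψ.hom) :
    stableRel (gorenstein.{w} W) ((cyclesZero W).map φ) ((cyclesZero W).map ψ) := by
  have hW := T'.property.prop_X (-1)
  refine ⟨⟨T'.obj.X (-1), gorenstein_of_prop hW⟩,
    ObjectProperty.homMk (T.obj.iCycles 0 ≫ h.hom 0 (-1)),
    ObjectProperty.homMk (T'.obj.toCycles (-1) 0), isRelProjective_of_prop _ hW,
    isRelInjective_of_prop _ hW, ?_⟩
  ext
  change HomologicalComplex.cyclesMap φ.hom 0 - HomologicalComplex.cyclesMap ψ.hom 0 =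
    (T.obj.iCycles 0 ≫ h.hom 0 (-1)) ≫ T'.obj.toCycles (-1) 0
  rw [← cancel_mono (T'.obj.iCycles 0), Preadditive.sub_comp, HomologicalComplex.cyclesMap_i,
    HomologicalComplex.cyclesMap_i, Category.assoc, Category.assoc, HomologicalComplex.toCycles_i,
    h.comm 0, dNext_eq h.hom (show (ComplexShape.up ℤ).Rel 0 1 by simp),
    prevD_eq h.hom (show (ComplexShape.up ℤ).Rel (-1) 0 by simp)]
  simp

variable (W) in
/-- The functor `Z₀` from the homotopy category of totally acyclic complexes to the stable category
of Gorenstein objects, sending a complex to its cycles in degree zero and the homotopy class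
of `φ` to the stable class of the morphism induced by `φ` on cycles. -/
noncomputable def stableCyclesZero : KTac.{w} W ⥤ StGor.{w} W where
  obj K := (toStable _).obj ((cyclesZero W).obj ⟨K.obj.as, K.property⟩)
  map {K K'} f := Quot.liftOn f.hom
    (fun φ : K.obj.as ⟶ K'.obj.as => (toStable _).map ((cyclesZero W).map
      (ObjectProperty.homMk φ : (⟨K.obj.as, K.property⟩ : Tac.{w} W) ⟶ ⟨K'.obj.as, K'.property⟩)))
    (fun φ ψ h => by
      rw [HomRel.compClosure_iff_self] at h
      obtain ⟨h⟩ := h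
      exact CategoryTheory.Quotient.sound _ (stableRel_of_homotopy h))
  map_id K := by
    change (toStable _).map ((cyclesZero W).map (𝟙 _)) = _
    simp
  map_comp {K K' K''} f g := by
    obtain ⟨⟨f⟩⟩ := f
    obtain ⟨⟨g⟩⟩ := g
    exact ((congrArg (toStable _).map ((cyclesZero W).map_comp
      (ObjectProperty.homMk f : (⟨K.obj.as, K.property⟩ : Tac.{w} W) ⟶ ⟨K'.obj.as, K'.property⟩)
      (ObjectProperty.homMk g : _ ⟶ (⟨K''.obj.as, K''.property⟩ : Tac.{w} W))))).trans
      ((toStable _).map_comp _ _)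

end CyclesFunctor

section CompleteResolutions

variable {A : Type u} [Category.{v} A] [Abelian A] [HasExt.{w} A] {W : ObjectProperty A}

variable (W) in
/-- A choice, for every `W`-Gorenstein object `M`, of a `W`-totally acyclic complex whose cycle
object in degree zero is identified with `M`. -/
structure CompleteResolutions where
  /-- The chosen complex. -/
  complex : Gor.{w} W → Tac.{w} W
  /-- The identification of its degree zero cycles. -/
  cyclesIso (M : Gor.{w} W) : (cyclesZero W).obj (complex M) ≅ M

variable (W) in
instance : Nonempty (CompleteResolutions.{w} W) :=
  ⟨{ complex := fun M => ⟨M.property.choose, M.property.choose_spec.1⟩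
     cyclesIso := fun M => ObjectProperty.isoMk _ M.property.choose_spec.2.some }⟩

/-- `T` is the functor induced by the chosen complexes: it sends `M` to the chosen complex of `M`,
and the stable class of `f : M ⟶ M'` to the homotopy class of any morphism of complexes which
lifts `f`. -/
def IsInducedByLifts (R : CompleteResolutions.{w} W) (T : StGor.{w} W ⥤ KTac.{w} W) : Prop :=
  ∃ h : ∀ M : Gor.{w} W, T.obj ((toStable _).obj M) = (toKTac W).obj (R.complex M),
    ∀ (M M' : Gor.{w} W) (f : M ⟶ M') (φ : R.complex M ⟶ R.complex M'),
      (cyclesZero W).map φ ≫ (R.cyclesIso M').hom = (R.cyclesIso M).hom ≫ f →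
        T.map ((toStable _).map f) = eqToHom (h M) ≫ (toKTac W).map φ ≫ eqToHom (h M').symm

end CompleteResolutions

section Classical

variable {A : Type u} [Category.{v} A] [Abelian A]

/-- The totally acyclic complexes of injective objects, in the classical sense. -/
def totallyAcyclicInjective : ObjectProperty (CochainComplex A ℤ) := fun T =>
  T.Acyclic ∧ (∀ i, Injective (T.X i)) ∧ ∀ I : A, Injective I → HomFromAcyclic I T

/-- The totally acyclic complexes of projective objects, in the classical sense. -/
def totallyAcyclicProjective : ObjectProperty (CochainComplex A ℤ) := fun T =>
  T.Acyclic ∧ (∀ i, Projective (T.X i)) ∧ ∀ P : A, Projective P → HomToAcyclic T P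

/-- Gorenstein injective objects. -/
def gorensteinInjective : ObjectProperty A := fun M =>
  ∃ T : CochainComplex A ℤ, totallyAcyclicInjective T ∧ Nonempty (T.cycles 0 ≅ M)

/-- Gorenstein projective objects. -/
def gorensteinProjective : ObjectProperty A := fun M =>
  ∃ T : CochainComplex A ℤ, totallyAcyclicProjective T ∧ Nonempty (T.cycles 0 ≅ M)

end Classical


end GorensteinStable

open GorensteinStable

namespace GorensteinStable

/-! ### Total acyclicity through the complexes Hom(M, T) and Hom(T, M) -/

section HomAcyclic

variable {A : Type u} [Category.{v} A] [Abelian A]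

/-! Write Z^i for cycles in cohomological degree i. Two properties of a W-totally acyclic complex T
drive the argument. For M in W, every map M ⟶ Z^{i+1}(T) lifts to T^i, because Ext¹(M, Z^i) = 0; and
every map Z^i(T) ⟶ M extends to T^i, because Hom(T, M) is acyclic. For self-orthogonal W this gives
a symmetric characterisation of total acyclicity (`isTotallyAcyclic_iff`), from which stability
under shifts and mapping cones can be read off, so the homotopy category of such complexes is
triangulated.

Starting in degree 0 and moving both ways, the two properties extend a map Z^0(T) ⟶ Z^0(T') to a
chain map (`IsTotallyAcyclic.exists_cyclesMap_eq`), and build a null homotopy of a chain map whose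
effect on Z^0 factors through T'^{-1} ⟶ Z^0(T') (`IsTotallyAcyclic.nonempty_homotopy_zero`). Hence
Z₀ is full, and faithful modulo maps through projective-injectives; it is essentially surjective by
the definition of Gorenstein objects.

The Frobenius structure comes from the sequences Z^i ⟶ T^i ⟶ Z^{i+1}, whose middle terms lie in W
and are both relatively projective and relatively injective. An extension of Gorenstein objects is
recognised as the cycles of a mapping cone.

The triangulation of the stable category is transported along Z₀ and then shown to be the usual one.
The conflation Z^0(T) ⟶ T^0 ⟶ Z^0(T[1]) identifies the shift with the cosyzygy
(`suspIso_naturality`). The sequence Z^0(K) ⟶ Z^0(L) ⊕ K^0 ⟶ Z^0(cone φ) turns cone triangles into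
triangles of conflations, and every conflation arises in this way up to stable isomorphism
(`nonempty_iso_stableConeTriangle`). A choice of complete resolutions gives a quasi-inverse of Z₀,
hence an adjoint on both sides.

In the classical cases one of the two Hom conditions holds for every acyclic complex, and the other
is the classical definition. -/

lemma homFromAcyclic_iff (M : A) (T : CochainComplex A ℤ) :
    HomFromAcyclic M T ↔ ∀ (i j k : ℤ), i + 1 = j → j + 1 = k → ∀ f : M ⟶ T.X j,
      f ≫ T.d j k = 0 → ∃ g : M ⟶ T.X i, g ≫ T.d i j = f := by
  have key : ∀ (i j k : ℤ) (hi : i + 1 = j) (hk : j + 1 = k),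
      (((preadditiveCoyoneda.obj (Opposite.op M)).mapHomologicalComplex _).obj T).ExactAt j ↔
      ∀ f : M ⟶ T.X j, f ≫ T.d j k = 0 → ∃ g : M ⟶ T.X i, g ≫ T.d i j = f := by
    intro i j k hi hk
    rw [HomologicalComplex.exactAt_iff' _ i j k
      (ComplexShape.prev_eq' _ (show (ComplexShape.up ℤ).Rel i j from hi))
      (ComplexShape.next_eq' _ (show (ComplexShape.up ℤ).Rel j k from hk)),
      ShortComplex.ab_exact_iff]
    rfl
  constructor
  · intro h i j k hi hk
    exact (key i j k hi hk).1 (h j)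
  · intro h j
    exact (key (j - 1) j (j + 1) (by lia) rfl).2 (h _ _ _ (by lia) rfl)

lemma epi_toCycles {T : CochainComplex A ℤ} (hT : T.Acyclic) (i j : ℤ) (hij : i + 1 = j) :
    Epi (T.toCycles i j) :=
  (shortExact_cycles hT i j hij).epi_g

/-- A morphism which is killed by the differential factors through the cycles. -/
lemma exists_toCycles_comp {T : CochainComplex A ℤ} (hT : T.Acyclic) {M : A} (i j : ℤ)
    (hij : i + 1 = j) (f : T.X i ⟶ M) (hf : T.iCycles i ≫ f = 0) :
    ∃ g : T.cycles j ⟶ M, T.toCycles i j ≫ g = f := by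
  have h := shortExact_cycles hT i j hij
  have := h.epi_g
  exact ⟨h.exact.desc f hf, h.exact.g_desc f hf⟩

/-- Precomposing `f` with the epimorphism T^{n-1} ⟶ Z^n gives a cocycle of Hom(T, M). A map that
bounds it extends `f`, since the epimorphism can be cancelled. -/
lemma exists_iCycles_extension {T : CochainComplex A ℤ} (hT : T.Acyclic) {M : A}
    (h : HomToAcyclic T M) (n : ℤ) (f : T.cycles n ⟶ M) :
    ∃ g : T.X n ⟶ M, T.iCycles n ≫ g = f := by
  have := epi_toCycles hT (n - 1) n (by lia)
  obtain ⟨g, hg⟩ := (homToAcyclic_iff T M).1 h (n - 1 - 1) (n - 1) n (by lia) (by lia)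
    (T.toCycles (n - 1) n ≫ f) (by simp)
  refine ⟨g, ?_⟩
  rw [← cancel_epi (T.toCycles (n - 1) n), ← hg, ← Category.assoc, T.toCycles_i]

lemma exists_toCycles_lift {T : CochainComplex A ℤ} {M : A} (h : HomFromAcyclic M T) (m n : ℤ)
    (hmn : m + 1 = n) (f : M ⟶ T.cycles n) : ∃ g : M ⟶ T.X m, g ≫ T.toCycles m n = f := by
  obtain ⟨g, hg⟩ := (homFromAcyclic_iff M T).1 h m n (n + 1) hmn rfl (f ≫ T.iCycles n) (by simp)
  exact ⟨g, by rw [← cancel_mono (T.iCycles n), Category.assoc, T.toCycles_i, hg]⟩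

variable [HasExt.{w} A] {W : ObjectProperty A}

/-- A cocycle M ⟶ T^j lands in Z^j, and the obstruction to lifting it to T^i lies in Ext¹(M, Z^i) =
0. -/
lemma IsTotallyAcyclic.homFromAcyclic {T : CochainComplex A ℤ} (hT : IsTotallyAcyclic.{w} W T)
    {M : A} (hM : W M) : HomFromAcyclic M T := by
  rw [homFromAcyclic_iff]
  intro i j k hi hk f hf
  obtain ⟨g, hg⟩ := exists_lift_of_ext (shortExact_cycles hT.acyclic i j hi)
    (hT.prop_cycles i M hM) (T.liftCycles f k (by simp [← hk]) hf)
  refine ⟨g, ?_⟩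
  dsimp at hg
  rw [← T.toCycles_i, reassoc_of% hg, T.liftCycles_i]

lemma IsTotallyAcyclic.exists_lift {T : CochainComplex A ℤ} (hT : IsTotallyAcyclic.{w} W T)
    {M : A} (hM : W M) (m n : ℤ) (hmn : m + 1 = n) (f : M ⟶ T.cycles n) :
    ∃ g : M ⟶ T.X m, g ≫ T.toCycles m n = f :=
  exists_toCycles_lift (hT.homFromAcyclic hM) m n hmn f

variable [IsSelfOrthogonal.{w} W]

lemma IsTotallyAcyclic.homToAcyclic {T : CochainComplex A ℤ} (hT : IsTotallyAcyclic.{w} W T)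
    {M : A} (hM : W M) : HomToAcyclic T M :=
  hT.hom_acyclic M hM fun _ hN => IsSelfOrthogonal.subsingleton_ext.{w} _ _ hN hM

/-- Trades the Ext condition on cycles for acyclicity of Hom(M, T). This form is symmetric, and
makes shifts, cones and the classical cases easy to check. -/
lemma isTotallyAcyclic_iff (T : CochainComplex A ℤ) :
    IsTotallyAcyclic.{w} W T ↔ T.Acyclic ∧ (∀ i, W (T.X i)) ∧
      ∀ M, W M → HomFromAcyclic M T ∧ HomToAcyclic T M := by
  constructor
  · intro hT
    exact ⟨hT.acyclic, hT.prop_X, fun M hM => ⟨hT.homFromAcyclic hM, hT.homToAcyclic hM⟩⟩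
  · rintro ⟨h₁, h₂, h₃⟩
    refine ⟨h₁, h₂, fun i M hM => ?_, fun M hM _ => (h₃ M hM).2⟩
    refine subsingleton_of_forall_eq 0 fun x => ?_
    have hS := shortExact_cycles h₁ i (i + 1) rfl
    have h₄ := IsSelfOrthogonal.subsingleton_ext.{w} _ _ hM (h₂ i)
    -- Since Ext¹(M, T^i) = 0, the class `x` is the connecting image of some M ⟶ Z^{i+1}. That map
    -- lifts to T^i, so its connecting image vanishes.
    obtain ⟨y, rfl⟩ := Abelian.Ext.covariant_sequence_exact₁ M hS x
      (Subsingleton.elim (α := Abelian.Ext M (T.X i) 1) _ _) (zero_add 1)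
    obtain ⟨u, rfl⟩ : ∃ u, y = Abelian.Ext.mk₀ u :=
      ⟨_, (Abelian.Ext.mk₀_homEquiv₀_apply y).symm⟩
    obtain ⟨g, rfl⟩ := exists_toCycles_lift (h₃ M hM).1 i (i + 1) rfl u
    have := hS.comp_extClass
    dsimp at this
    rw [← Abelian.Ext.mk₀_comp_mk₀, Abelian.Ext.comp_assoc_of_second_deg_zero, this,
      Abelian.Ext.comp_zero]

lemma IsTotallyAcyclic.exists_extension {T : CochainComplex A ℤ} (hT : IsTotallyAcyclic.{w} W T)
    {M : A} (hM : W M) (n : ℤ) (f : T.cycles n ⟶ M) : ∃ g : T.X n ⟶ M, T.iCycles n ≫ g = f :=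
  exists_iCycles_extension hT.acyclic (hT.homToAcyclic hM) n f

end HomAcyclic

/-! ### Shifts of totally acyclic complexes -/

section Shift

variable {A : Type u} [Category.{v} A] [Abelian A] [HasExt.{w} A] {W : ObjectProperty A}
  [IsSelfOrthogonal.{w} W]

/-- The differential changes only by the unit (-1)^n. In both Hom conditions the primitive is
multiplied by the same unit, and the two factors cancel. -/
lemma IsTotallyAcyclic.shift {T : CochainComplex A ℤ} (hT : IsTotallyAcyclic.{w} W T) (n : ℤ) :
    IsTotallyAcyclic.{w} W (T⟦n⟧) := by
  rw [isTotallyAcyclic_iff]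
  refine ⟨?_, fun i => hT.prop_X _, fun M hM => ⟨?_, ?_⟩⟩
  · have := (HomotopyCategory.subcategoryAcyclic A).le_shift n _
      ((HomotopyCategory.quotient_obj_mem_subcategoryAcyclic_iff_acyclic T).2 hT.acyclic)
    rw [ObjectProperty.prop_shift_iff, HomotopyCategory.shift_quotient_obj] at this
    exact (HomotopyCategory.quotient_obj_mem_subcategoryAcyclic_iff_acyclic (T⟦n⟧)).1 this
  · rw [homFromAcyclic_iff]
    intro i j k hi hk (f : M ⟶ T.X (j + n)) hf
    obtain ⟨g, hg⟩ := (homFromAcyclic_iff M T).1 (hT.homFromAcyclic hM) (i + n) (j + n) (k + n)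
      (by lia) (by lia) f (by
        change f ≫ (n.negOnePow • T.d (j + n) (k + n)) = 0 at hf
        rwa [Linear.comp_units_smul, smul_eq_zero_iff_eq] at hf)
    refine ⟨(n.negOnePow • g : M ⟶ T.X (i + n)), ?_⟩
    change (n.negOnePow • g) ≫ (n.negOnePow • T.d (i + n) (j + n)) = f
    rw [Linear.comp_units_smul, Linear.units_smul_comp, smul_smul, hg]
    simp
  · rw [homToAcyclic_iff]
    intro i j k hi hk (f : T.X (j + n) ⟶ M) hf
    obtain ⟨g, hg⟩ := (homToAcyclic_iff T M).1 (hT.homToAcyclic hM) (i + n) (j + n) (k + n)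
      (by lia) (by lia) f (by
        change (n.negOnePow • T.d (i + n) (j + n)) ≫ f = 0 at hf
        rwa [Linear.units_smul_comp, smul_eq_zero_iff_eq] at hf)
    refine ⟨(n.negOnePow • g : T.X (k + n) ⟶ M), ?_⟩
    change (n.negOnePow • T.d (j + n) (k + n)) ≫ (n.negOnePow • g) = f
    rw [Linear.comp_units_smul, Linear.units_smul_comp, smul_smul, hg]
    simp

end Shift

/-! ### Mapping cones and the triangulated subcategory of totally acyclic complexes -/

section MappingCone

open CochainComplex

variable {A : Type u} [Category.{v} A] [Abelian A]

lemma acyclic_mappingCone {K L : CochainComplex A ℤ} (φ : K ⟶ L) (hK : K.Acyclic)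
    (hL : L.Acyclic) : (mappingCone φ).Acyclic :=
  (HomotopyCategory.quotient_obj_mem_subcategoryAcyclic_iff_acyclic _).1
    ((HomotopyCategory.subcategoryAcyclic A).ext_of_isTriangulatedClosed₃ _
      (HomotopyCategory.mappingCone_triangleh_distinguished φ)
      ((HomotopyCategory.quotient_obj_mem_subcategoryAcyclic_iff_acyclic K).2 hK)
      ((HomotopyCategory.quotient_obj_mem_subcategoryAcyclic_iff_acyclic L).2 hL))

/-- The component of a cocycle in K is itself a cocycle, hence equals `a ≫ d`. Adding `a ≫ φ` to the
component in L makes that a cocycle, equal to `b ≫ d`. The primitive is then (-a, b). -/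
lemma HomFromAcyclic.mappingCone {K L : CochainComplex A ℤ} {M : A} (φ : K ⟶ L)
    (hK : HomFromAcyclic M K) (hL : HomFromAcyclic M L) : HomFromAcyclic M (mappingCone φ) := by
  rw [homFromAcyclic_iff] at hK hL ⊢
  intro i j k hi hk f hf
  obtain ⟨a, ha⟩ := hK j k (k + 1) hk rfl (f ≫ (mappingCone.fst φ).1.v j k hk) (by
    have := hf =≫ (mappingCone.fst φ).1.v k (k + 1) rfl
    rw [Category.assoc, mappingCone.d_fst_v φ j k (k + 1) hk rfl, zero_comp,
      Preadditive.comp_neg, neg_eq_zero] at this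
    rw [Category.assoc, this])
  obtain ⟨b, hb⟩ := hL i j k hi hk
    (f ≫ (mappingCone.snd φ).v j j (add_zero j) + a ≫ φ.f j) (by
      have := hf =≫ (mappingCone.snd φ).v k k (add_zero k)
      rw [Category.assoc, mappingCone.d_snd_v φ j k hk, zero_comp, Preadditive.comp_add,
        ← Category.assoc, ← ha] at this
      rw [Preadditive.add_comp, Category.assoc, Category.assoc, φ.comm, ← this, Category.assoc, add_comm])
  refine ⟨-a ≫ (mappingCone.inl φ).v j i (by lia) + b ≫ (mappingCone.inr φ).f i, ?_⟩
  rw [mappingCone.ext_to_iff φ j k hk]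
  constructor
  · simp [mappingCone.inl_v_d φ j i k (by lia) (by lia), ha]
  · simp [mappingCone.inl_v_d φ j i k (by lia) (by lia), hb]

/-- Dual elimination: the restriction to L is a cocycle bounded by `b`, and the restriction to K
minus `φ ≫ b` is then a cocycle bounded by `a`. -/
lemma HomToAcyclic.mappingCone {K L : CochainComplex A ℤ} {M : A} (φ : K ⟶ L)
    (hK : HomToAcyclic K M) (hL : HomToAcyclic L M) : HomToAcyclic (mappingCone φ) M := by
  rw [homToAcyclic_iff] at hK hL ⊢
  intro i j k hi hk f hf
  obtain ⟨b, hb⟩ := hL i j k hi hk ((mappingCone.inr φ).f j ≫ f) (by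
    rw [← (mappingCone.inr φ).comm_assoc, hf, comp_zero])
  obtain ⟨a, ha⟩ := hK j k (k + 1) hk rfl
    ((mappingCone.inl φ).v k j (by lia) ≫ f - φ.f k ≫ b) (by
      have := (mappingCone.inl φ).v j i (by lia) ≫= hf
      rw [mappingCone.inl_v_d_assoc φ j i k (by lia) (by lia), comp_zero, Preadditive.sub_comp,
        Category.assoc, Category.assoc, ← hb, sub_eq_zero] at this
      rw [Preadditive.comp_sub, ← this, ← φ.comm_assoc, sub_self])
  refine ⟨-(mappingCone.fst φ).1.v k (k + 1) rfl ≫ a + (mappingCone.snd φ).v k k (add_zero k) ≫ b,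
    ?_⟩
  rw [mappingCone.ext_from_iff φ k j hk]
  constructor
  · simp [mappingCone.inl_v_d_assoc φ k j (k + 1) (by lia) (by lia), ha]
  · simp [hb]

variable [HasExt.{w} A] {W : ObjectProperty A} [IsSelfOrthogonal.{w} W]
  [W.IsClosedUnderBinaryProducts] [W.IsClosedUnderIsomorphisms]

lemma IsTotallyAcyclic.mappingCone {K L : CochainComplex A ℤ} (hK : IsTotallyAcyclic.{w} W K)
    (hL : IsTotallyAcyclic.{w} W L) (φ : K ⟶ L) : IsTotallyAcyclic.{w} W (mappingCone φ) := by
  rw [isTotallyAcyclic_iff]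
  refine ⟨acyclic_mappingCone φ hK.acyclic hL.acyclic, fun i => ?_, fun M hM =>
    ⟨(hK.homFromAcyclic hM).mappingCone φ (hL.homFromAcyclic hM),
      (hK.homToAcyclic hM).mappingCone φ (hL.homToAcyclic hM)⟩⟩
  exact W.prop_of_iso ((HomologicalComplex.homotopyCofiber.XIsoBiprod φ i (i + 1) rfl) ≪≫
    biprod.isoProd _ _).symm (W.prop_prod _ _ (hK.prop_X (i + 1)) (hL.prop_X i))

/-- The property is imposed on the underlying complex and need not be invariant under homotopy
equivalence. Closure under cones is therefore obtained up to isomorphism: the third object of a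
distinguished triangle is compared with the mapping cone of a representative of its first map. -/
instance isTriangulated_homotopyTotallyAcyclic [W.ContainsZero] :
    (homotopyTotallyAcyclic.{w} W).IsTriangulated :=
  have : (homotopyTotallyAcyclic.{w} W).IsStableUnderShift ℤ :=
    ⟨fun n => ⟨fun K hK => by
      obtain ⟨K, rfl⟩ := K.quotient_obj_surjective
      rw [ObjectProperty.prop_shift_iff, HomotopyCategory.shift_quotient_obj]
      exact IsTotallyAcyclic.shift hK n⟩⟩
  have : (homotopyTotallyAcyclic.{w} W).IsTriangulatedClosed₃ := ⟨by
    intro T hT h₁ h₂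
    obtain ⟨φ, hφ⟩ := (HomotopyCategory.quotient A (ComplexShape.up ℤ)).map_surjective
      (X := T.obj₁.as) (Y := T.obj₂.as) T.mor₁
    refine ⟨_, IsTotallyAcyclic.mappingCone h₁ h₂ φ, ⟨?_⟩⟩
    exact Triangle.π₃.mapIso (isoTriangleOfIso₁₂ _ _ hT
      (HomotopyCategory.mappingCone_triangleh_distinguished φ) (Iso.refl _) (Iso.refl _) (by
        rw [Iso.refl_hom, Iso.refl_hom]
        exact (Category.comp_id _).trans (hφ.symm.trans (Category.id_comp _).symm)))⟩
  have : (homotopyTotallyAcyclic.{w} W).ContainsZero := ⟨by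
    have hX : ∀ i, IsZero ((0 : CochainComplex A ℤ).X i) := fun i =>
      (HomologicalComplex.eval A _ i).map_isZero (isZero_zero _)
    refine ⟨(HomotopyCategory.quotient A _).obj 0,
      (HomotopyCategory.quotient A _).map_isZero (isZero_zero _),
      isTotallyAcyclic_of_contraction _ (fun i => W.prop_of_isZero (hX i)) ?_⟩
    intro i j k _ _
    exact ⟨0, 0, (hX j).eq_of_src _ _⟩⟩
  have := ObjectProperty.IsTriangulatedClosed₂.of_isTriangulatedClosed₃
    (P := homotopyTotallyAcyclic.{w} W)
  { }

end MappingCone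

/-! ### Lifting morphisms and homotopies from degree zero cycles -/

section Comparison

/-- Two-sided dependent choice along the integers. -/
lemma exists_int_family {α : ℤ → Type*} (R : ∀ i j : ℤ, i + 1 = j → α i → α j → Prop)
    (up : ∀ (i j : ℤ) (h : i + 1 = j) (a : α i), ∃ b, R i j h a b)
    (down : ∀ (i j : ℤ) (h : i + 1 = j) (b : α j), ∃ a, R i j h a b) (a₀ : α 0) :
    ∃ s : ∀ i, α i, s 0 = a₀ ∧ ∀ (i j : ℤ) (h : i + 1 = j), R i j h (s i) (s j) := by
  choose f hf using up
  choose g hg using down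
  let p : ∀ n : ℕ, α (Int.ofNat n) := fun n =>
    Nat.rec a₀ (fun n a => f (Int.ofNat n) (Int.ofNat (n + 1)) rfl a) n
  let q : ∀ n : ℕ, α (Int.negSucc n) := fun n =>
    Nat.rec (g (Int.negSucc 0) 0 rfl a₀)
      (fun n a => g (Int.negSucc (n + 1)) (Int.negSucc n) (by lia) a) n
  refine ⟨fun i => match i with
    | Int.ofNat n => p n
    | Int.negSucc n => q n, rfl, ?_⟩
  rintro (n | _ | n) j h
  · obtain rfl : j = Int.ofNat (n + 1) := h.symm
    exact hf _ _ _ _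
  · obtain rfl : j = Int.ofNat 0 := h.symm
    exact hg _ _ _ _
  · obtain rfl : j = Int.negSucc n := by rw [← h]; lia
    exact hg _ _ _ _

section

variable {A : Type u} [Category.{v} A] [Abelian A]

@[simp]
lemma iCycles_toCycles (T : CochainComplex A ℤ) (i j : ℤ) : T.iCycles i ≫ T.toCycles i j = 0 := by
  rw [← cancel_mono (T.iCycles j), Category.assoc, T.toCycles_i, zero_comp, T.iCycles_d]

@[simp]
lemma iCycles_toCycles_assoc (T : CochainComplex A ℤ) (i j : ℤ) {M : A} (f : T.cycles j ⟶ M) :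
    T.iCycles i ≫ T.toCycles i j ≫ f = 0 := by
  rw [← Category.assoc, iCycles_toCycles, zero_comp]

/-- Isomorphic objects with the same kernel of the differential have isomorphic cycles. -/
noncomputable def cyclesIsoOfXIso {K L : CochainComplex A ℤ} (i j : ℤ) (e : K.X i ≅ L.X j)
    (h : ∀ (M : A) (f : M ⟶ K.X i), f ≫ K.d i (i + 1) = 0 ↔ (f ≫ e.hom) ≫ L.d j (j + 1) = 0) :
    K.cycles i ≅ L.cycles j where
  hom := L.liftCycles (K.iCycles i ≫ e.hom) (j + 1) (by simp) ((h _ _).1 (by simp))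
  inv := K.liftCycles (L.iCycles j ≫ e.inv) (i + 1) (by simp) ((h _ _).2 (by simp))
  hom_inv_id := by
    rw [← cancel_mono (K.iCycles i)]
    simp
  inv_hom_id := by
    rw [← cancel_mono (L.iCycles j)]
    simp

lemma cyclesIsoOfXIso_hom_iCycles {K L : CochainComplex A ℤ} (i j : ℤ) (e : K.X i ≅ L.X j)
    (h : ∀ (M : A) (f : M ⟶ K.X i), f ≫ K.d i (i + 1) = 0 ↔ (f ≫ e.hom) ≫ L.d j (j + 1) = 0) :
    (cyclesIsoOfXIso i j e h).hom ≫ L.iCycles j = K.iCycles i ≫ e.hom := by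
  simp [cyclesIsoOfXIso]

lemma comp_shift_d_eq_zero_iff (T : CochainComplex A ℤ) (n i j : ℤ) {M : A}
    (f : M ⟶ T.X (i + n)) :
    (show M ⟶ (T⟦n⟧).X i from f) ≫ (T⟦n⟧).d i j = 0 ↔ f ≫ T.d (i + n) (j + n) = 0 := by
  change f ≫ (n.negOnePow • T.d (i + n) (j + n)) = 0 ↔ _
  rw [Linear.comp_units_smul, smul_eq_zero_iff_eq]

/-- The terms of a shifted complex. -/
def shiftXIso (T : CochainComplex A ℤ) (n i j : ℤ) (h : i + n = j) : (T⟦n⟧).X i ≅ T.X j :=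
  T.XIsoOfEq h

/-- The cycles of a shifted complex. -/
noncomputable def cyclesShiftIso (T : CochainComplex A ℤ) (n i j : ℤ) (h : i + n = j) :
    (T⟦n⟧).cycles i ≅ T.cycles j :=
  cyclesIsoOfXIso i j (shiftXIso T n i j h) (by
    subst h
    intro M (f : M ⟶ T.X (i + n))
    refine (comp_shift_d_eq_zero_iff T n i (i + 1) f).trans ?_
    have e : i + 1 + n = i + n + 1 := by lia
    change f ≫ T.d (i + n) (i + 1 + n) = 0 ↔ (f ≫ 𝟙 (T.X (i + n))) ≫ T.d (i + n) (i + n + 1) = 0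
    rw [e, Category.comp_id])

lemma cyclesShiftIso_hom_iCycles (T : CochainComplex A ℤ) (n i j : ℤ) (h : i + n = j) :
    (cyclesShiftIso T n i j h).hom ≫ T.iCycles j =
      (T⟦n⟧).iCycles i ≫ (shiftXIso T n i j h).hom := by
  rw [cyclesShiftIso, cyclesIsoOfXIso_hom_iCycles]

end

variable {A : Type u} [Category.{v} A] [Abelian A] [HasExt.{w} A] {W : ObjectProperty A}
  [IsSelfOrthogonal.{w} W]

/-- Morphisms between cycle objects lift to morphisms of totally acyclic complexes. -/
lemma IsTotallyAcyclic.exists_cyclesMap_eq {T T' : CochainComplex A ℤ}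
    (hT : IsTotallyAcyclic.{w} W T) (hT' : IsTotallyAcyclic.{w} W T')
    (f : T.cycles 0 ⟶ T'.cycles 0) :
    ∃ φ : T ⟶ T', HomologicalComplex.cyclesMap φ 0 = f := by
  -- The family consists of the maps on cycles, and consecutive members are linked by a component of
  -- the chain map. Upwards, extend to T^i and pass to the quotient; downwards, lift to T'^i and
  -- restrict to the kernel.
  obtain ⟨s, hs, h⟩ := exists_int_family (α := fun i => T.cycles i ⟶ T'.cycles i)
    (fun i j _ a b => ∃ φ : T.X i ⟶ T'.X i, T.iCycles i ≫ φ = a ≫ T'.iCycles i ∧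
      φ ≫ T'.toCycles i j = T.toCycles i j ≫ b) (by
      intro i j hij a
      obtain ⟨φ, hφ⟩ := hT.exists_extension (hT'.prop_X i) i (a ≫ T'.iCycles i)
      obtain ⟨b, hb⟩ := exists_toCycles_comp hT.acyclic i j hij (φ ≫ T'.toCycles i j) (by
        rw [reassoc_of% hφ, iCycles_toCycles, comp_zero])
      exact ⟨b, φ, hφ, hb.symm⟩) (by
      intro i j hij b
      obtain ⟨φ, hφ⟩ := hT'.exists_lift (hT.prop_X i) i j hij (T.toCycles i j ≫ b)
      have hw := T.iCycles i ≫= hφ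
      have hS := shortExact_cycles hT'.acyclic i j hij
      have := hS.mono_f
      rw [← Category.assoc, ← Category.assoc (T.iCycles i),
        iCycles_toCycles, zero_comp] at hw
      exact ⟨hS.exact.lift _ hw, φ, (hS.exact.lift_f _ hw).symm, hφ⟩) f
  choose φ hφ using fun i => h i (i + 1) rfl
  let Φ : T ⟶ T' :=
    { f := φ
      comm' := by
        rintro i j (rfl : i + 1 = j)
        rw [← T'.toCycles_i i (i + 1), reassoc_of% (hφ i).2, ← (hφ (i + 1)).1,
          T.toCycles_i_assoc] }
  refine ⟨Φ, ?_⟩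
  rw [← cancel_mono (T'.iCycles 0), HomologicalComplex.cyclesMap_i, ← hs]
  exact (hφ 0).1

/-- A morphism of totally acyclic complexes is null homotopic when the induced morphism on cycles
factors through the differential of the target. -/
lemma IsTotallyAcyclic.nonempty_homotopy_zero {T T' : CochainComplex A ℤ}
    (hT : IsTotallyAcyclic.{w} W T) (hT' : IsTotallyAcyclic.{w} W T') (φ : T ⟶ T')
    (a : T.cycles 0 ⟶ T'.X (-1))
    (ha : HomologicalComplex.cyclesMap φ 0 = a ≫ T'.toCycles (-1) 0) :
    Nonempty (Homotopy φ 0) := by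
  -- An element of `α i` is a homotopy component T^i ⟶ T'^{i-1}, given for every `m` with `m + 1 =
  -- i` to avoid transporting along equalities of degrees. The condition, that φ agrees with `h ≫ d`
  -- on Z^i, is the invariant that lets the construction continue in either direction.
  let α : ℤ → Type _ := fun i => { h : ∀ m, m + 1 = i → (T.X i ⟶ T'.X m) //
    ∀ m hm, HomologicalComplex.cyclesMap φ i = T.iCycles i ≫ h m hm ≫ T'.toCycles m i }
  have mk : ∀ (m i : ℤ) (hm : m + 1 = i) (h : T.X i ⟶ T'.X m), HomologicalComplex.cyclesMap φ i =
      T.iCycles i ≫ h ≫ T'.toCycles m i → ∃ b : α i, b.1 m hm = h := by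
    intro m i hm h hh
    refine ⟨⟨fun m' hm' => h ≫ (T'.XIsoOfEq (by lia : m = m')).hom, fun m' hm' => ?_⟩, by simp⟩
    obtain rfl : m = m' := by lia
    simpa using hh
  obtain ⟨a', ha'⟩ := hT.exists_extension (hT'.prop_X (-1)) 0 a
  obtain ⟨s₀, -⟩ := mk (-1) 0 (by simp) a' (by rw [reassoc_of% ha', ha])
  obtain ⟨s, -, hs⟩ := exists_int_family (α := α)
    (fun i j hij x y => ∀ m (hm : m + 1 = i),
      φ.f i = x.1 m hm ≫ T'.d m i + T.d i j ≫ y.1 i hij) (by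
      intro i j hij x
      obtain ⟨m, hm⟩ : ∃ m, m + 1 = i := ⟨i - 1, by simp⟩
      -- By the invariant the difference vanishes on Z^i, so it factors through Z^j. Extending the
      -- factor to T^j gives the next component.
      obtain ⟨u, hu⟩ := exists_toCycles_comp hT.acyclic i j hij (φ.f i - x.1 m hm ≫ T'.d m i) (by
        have := x.2 m hm =≫ T'.iCycles i
        rw [HomologicalComplex.cyclesMap_i, Category.assoc, Category.assoc, T'.toCycles_i] at this
        rw [Preadditive.comp_sub, this, sub_self])
      obtain ⟨h, hh⟩ := hT.exists_extension (hT'.prop_X i) j u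
      have e : T.d i j ≫ h = φ.f i - x.1 m hm ≫ T'.d m i := by
        rw [← T.toCycles_i, Category.assoc, hh, hu]
      obtain ⟨y, hy⟩ := mk i j hij h (by
        have := epi_toCycles hT.acyclic i j hij
        rw [← cancel_epi (T.toCycles i j), T.toCycles_i_assoc, reassoc_of% e,
          Preadditive.sub_comp, Category.assoc, ← cancel_mono (T'.iCycles j)]
        simp)
      refine ⟨y, fun m' hm' => ?_⟩
      obtain rfl : m = m' := by lia
      rw [hy, e, add_sub_cancel]) (by
      intro i j hij y
      obtain ⟨m, hm⟩ : ∃ m, m + 1 = i := ⟨i - 1, by simp⟩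
      -- The invariant in degree `j` makes this difference land in the cycles of T'. As T^i is in W,
      -- it then lifts to T'^{i-1}.
      have hw : (φ.f i - T.d i j ≫ y.1 i hij) ≫ T'.d i j = 0 := by
        have := (T.toCycles i j ≫= y.2 i hij) =≫ T'.iCycles j
        simp only [Category.assoc, HomologicalComplex.cyclesMap_i, T.toCycles_i_assoc,
          T'.toCycles_i] at this
        rw [Preadditive.sub_comp, φ.comm, Category.assoc, ← this, sub_self]
      obtain ⟨h, hh⟩ := hT'.exists_lift (hT.prop_X i) m i hm
        (T'.liftCycles _ j (by simp [hij]) hw)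
      have e : h ≫ T'.d m i = φ.f i - T.d i j ≫ y.1 i hij := by
        rw [← T'.toCycles_i, reassoc_of% hh, T'.liftCycles_i]
      obtain ⟨x, hx⟩ := mk m i hm h (by
        rw [← cancel_mono (T'.iCycles i), HomologicalComplex.cyclesMap_i, Category.assoc,
          Category.assoc, T'.toCycles_i, e]
        simp)
      refine ⟨x, fun m' hm' => ?_⟩
      obtain rfl : m = m' := by lia
      rw [hx, e, sub_add_cancel]) s₀
  refine ⟨{ hom := fun i j => if h : j + 1 = i then (s i).1 j h else 0
            zero := fun i j h => dif_neg h
            comm := fun i => ?_ }⟩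
  rw [dNext_eq _ (show (ComplexShape.up ℤ).Rel i (i + 1) from rfl),
    prevD_eq _ (show (ComplexShape.up ℤ).Rel (i - 1) i by simp), hs i (i + 1) rfl (i - 1) (by simp)]
  simp [add_comm]

end Comparison

/-! ### Stable equality on cycles implies homotopy -/

section FullyFaithful

variable {A : Type u} [Category.{v} A] [Abelian A] [HasExt.{w} A] {W : ObjectProperty A}
  [IsSelfOrthogonal.{w} W]

instance full_cyclesZero : (cyclesZero.{w} W).Full where
  map_surjective {T T'} f := by
    obtain ⟨φ, hφ⟩ := T.property.exists_cyclesMap_eq T'.property f.hom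
    exact ⟨ObjectProperty.homMk φ, by ext; exact hφ⟩

variable [W.ContainsZero] [W.IsClosedUnderIsomorphisms]

/-- The difference on Z^0 factors through a relatively projective object, whose map to Z^0(T') lifts
along the conflation Z^{-1} ⟶ T'^{-1} ⟶ Z^0. The difference therefore factors through T'^{-1}, as
the homotopy criterion requires. -/
lemma nonempty_homotopy_of_stableRel {T T' : Tac.{w} W} {φ ψ : T ⟶ T'}
    (h : stableRel (gorenstein.{w} W) ((cyclesZero W).map φ) ((cyclesZero W).map ψ)) :
    Nonempty (Homotopy φ.hom ψ.hom) := by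
  obtain ⟨P, a, b, hP, -, e⟩ := h
  have hS := shortExact_cycles T'.property.acyclic (-1) 0 (by simp)
  have hG : gorenstein.{w} W (T'.obj.cycles (-1)) := by
    refine ⟨T'.obj⟦(-1 : ℤ)⟧, T'.property.shift _, ⟨cyclesShiftIso _ _ _ _ (by simp)⟩⟩
  let S : ShortComplex (Gor.{w} W) := ShortComplex.mk
    (ObjectProperty.homMk (T'.obj.iCycles (-1)) : (⟨_, hG⟩ : Gor.{w} W) ⟶
      ⟨_, gorenstein_of_prop (T'.property.prop_X (-1))⟩)
    (ObjectProperty.homMk (T'.obj.toCycles (-1) 0) : _ ⟶ (cyclesZero W).obj T')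
    (by ext; exact iCycles_toCycles _ _ _)
  obtain ⟨c, hc⟩ := hP S hS b
  obtain ⟨H⟩ := T.property.nonempty_homotopy_zero T'.property (φ.hom - ψ.hom) (a.hom ≫ c.hom) (by
    have e₁ := congrArg (fun f => f.hom) e
    have e₂ := congrArg (fun f => f.hom) hc
    change HomologicalComplex.cyclesMap φ.hom 0 - HomologicalComplex.cyclesMap ψ.hom 0 =
      a.hom ≫ b.hom at e₁
    change c.hom ≫ T'.obj.toCycles (-1) 0 = b.hom at e₂
    refine ((HomologicalComplex.cyclesFunctor A (ComplexShape.up ℤ) 0).map_sub).trans ?_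
    exact e₁.trans ((congrArg (fun f => a.hom ≫ f) e₂.symm).trans (Category.assoc _ _ _).symm))
  exact ⟨Homotopy.equivSubZero.symm H⟩

end FullyFaithful

/-! ### Cycles of a mapping cone, as an extension and as a pushout -/

section ConeCycles

open CochainComplex

variable {A : Type u} [Category.{v} A] [Abelian A] {K L : CochainComplex A ℤ} (φ : K ⟶ L)

/-- The projection from the cycles of the mapping cone to the cycles of the source. -/
noncomputable def coneCyclesFst (i j : ℤ) (hij : i + 1 = j) :
    (mappingCone φ).cycles i ⟶ K.cycles j :=
  K.liftCycles ((mappingCone φ).iCycles i ≫ (mappingCone.fst φ).1.v i j hij) (j + 1) (by simp) (by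
    have h := (mappingCone φ).iCycles i ≫= mappingCone.d_fst_v φ i j (j + 1) hij rfl
    rw [HomologicalComplex.iCycles_d_assoc, zero_comp, Preadditive.comp_neg, zero_eq_neg] at h
    rwa [Category.assoc])

@[simp]
lemma coneCyclesFst_iCycles (i j : ℤ) (hij : i + 1 = j) :
    coneCyclesFst φ i j hij ≫ K.iCycles j =
      (mappingCone φ).iCycles i ≫ (mappingCone.fst φ).1.v i j hij := by
  simp [coneCyclesFst]

/-- The morphism from a term of the source to the cycles of the mapping cone. -/
noncomputable def toConeCycles (m i : ℤ) (hmi : m + 1 = i) : K.X i ⟶ (mappingCone φ).cycles i :=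
  (mappingCone.inl φ).v i m (by lia) ≫ (mappingCone φ).toCycles m i

lemma toConeCycles_iCycles (m i j : ℤ) (hmi : m + 1 = i) (hij : i + 1 = j) :
    toConeCycles φ m i hmi ≫ (mappingCone φ).iCycles i =
      φ.f i ≫ (mappingCone.inr φ).f i - K.d i j ≫ (mappingCone.inl φ).v j i (by lia) := by
  rw [toConeCycles, Category.assoc, HomologicalComplex.toCycles_i,
    mappingCone.inl_v_d φ i m j (by lia) (by lia)]

/-- The sign is that of the differential on the shifted copy of K inside the cone. -/
lemma toConeCycles_coneCyclesFst (m i j : ℤ) (hmi : m + 1 = i) (hij : i + 1 = j) :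
    toConeCycles φ m i hmi ≫ coneCyclesFst φ i j hij = -K.toCycles i j := by
  rw [← cancel_mono (K.iCycles j), Category.assoc, coneCyclesFst_iCycles, ← Category.assoc,
    toConeCycles_iCycles φ m i j hmi hij]
  simp

/-- This is the commutative square exhibiting Z^i(cone φ) as the pushout of Z^i(L) and K^i over
Z^i(K). -/
lemma iCycles_toConeCycles (m i : ℤ) (hmi : m + 1 = i) :
    K.iCycles i ≫ toConeCycles φ m i hmi = HomologicalComplex.cyclesMap φ i ≫
      HomologicalComplex.cyclesMap (mappingCone.inr φ) i := by
  rw [← cancel_mono ((mappingCone φ).iCycles i), Category.assoc,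
    toConeCycles_iCycles φ m i (i + 1) hmi rfl]
  simp

lemma cyclesMap_inr_coneCyclesFst (i j : ℤ) (hij : i + 1 = j) :
    HomologicalComplex.cyclesMap (mappingCone.inr φ) i ≫ coneCyclesFst φ i j hij = 0 := by
  rw [← cancel_mono (K.iCycles j)]
  simp

lemma mono_cyclesMap_inr (i : ℤ) :
    Mono (HomologicalComplex.cyclesMap (mappingCone.inr φ) i) := by
  refine Preadditive.mono_of_cancel_zero _ fun g hg => ?_
  have h := hg =≫ ((mappingCone φ).iCycles i ≫ (mappingCone.snd φ).v i i (add_zero i))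
  rw [← cancel_mono (L.iCycles i)]
  simpa using h

/-- The cycles of a mapping cone are an extension. -/
lemma shortExact_coneCycles (hK : K.Acyclic) (i j : ℤ) (hij : i + 1 = j) :
    (ShortComplex.mk _ _ (cyclesMap_inr_coneCyclesFst φ i j hij)).ShortExact where
  mono_f := mono_cyclesMap_inr φ i
  epi_g := by
    -- Up to sign the epimorphism K^i ⟶ Z^j(K) factors through the projection.
    have := epi_toCycles hK i j hij
    refine Preadditive.epi_of_cancel_zero _ fun g hg => ?_
    rw [← cancel_epi (K.toCycles i j), comp_zero, ← neg_eq_zero, ← Preadditive.neg_comp,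
      ← toConeCycles_coneCyclesFst φ (i - 1) i j (by lia) hij, Category.assoc, hg, comp_zero]
  exact := by
    have := mono_cyclesMap_inr φ i
    apply ShortComplex.exact_of_f_is_kernel
    refine KernelFork.IsLimit.ofι' _ _ fun {B} (k : B ⟶ (mappingCone φ).cycles i)
      (hk : k ≫ coneCyclesFst φ i j hij = 0) => ?_
    have h₁ : k ≫ (mappingCone φ).iCycles i ≫ (mappingCone.fst φ).1.v i j hij = 0 := by
      rw [← coneCyclesFst_iCycles, reassoc_of% hk, zero_comp]
    have h₂ := mappingCone.d_snd_v φ i j hij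
    refine ⟨L.liftCycles (k ≫ (mappingCone φ).iCycles i ≫ (mappingCone.snd φ).v i i (add_zero i))
      j (by simp [hij]) ?_, ?_⟩
    · have h₃ := (k ≫ (mappingCone φ).iCycles i) ≫= h₂
      simp only [Category.assoc, HomologicalComplex.iCycles_d_assoc, zero_comp, comp_zero,
        Preadditive.comp_add, reassoc_of% h₁, zero_add] at h₃
      simpa using h₃.symm
    · rw [← cancel_mono ((mappingCone φ).iCycles i), mappingCone.ext_to_iff φ i j hij]
      simp [h₁]

/-- Exactness in the middle of the pushout sequence. Projecting the relation to Z^{i+1}(K) shows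
that `k₂` lands in cycles; then `k₁` is determined because Z^i(L) ⟶ Z^i(cone φ) is mono. -/
lemma exists_cyclesMap_lift (m i : ℤ) (hmi : m + 1 = i) {B : A}
    (k₁ : B ⟶ L.cycles i) (k₂ : B ⟶ K.X i)
    (hk : k₁ ≫ HomologicalComplex.cyclesMap (mappingCone.inr φ) i +
      k₂ ≫ toConeCycles φ m i hmi = 0) :
    ∃ z : B ⟶ K.cycles i, z ≫ HomologicalComplex.cyclesMap φ i = k₁ ∧ z ≫ K.iCycles i = -k₂ := by
  have h₁ : k₂ ≫ K.toCycles i (i + 1) = 0 := by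
    have := hk =≫ coneCyclesFst φ i (i + 1) rfl
    rw [Preadditive.add_comp, Category.assoc, cyclesMap_inr_coneCyclesFst, Category.assoc,
      toConeCycles_coneCyclesFst] at this
    simpa using this
  obtain ⟨z, hz⟩ : ∃ z : B ⟶ K.cycles i, z ≫ K.iCycles i = k₂ :=
    ⟨K.liftCycles k₂ (i + 1) (by simp) (by rw [← K.toCycles_i, reassoc_of% h₁, zero_comp]),
      K.liftCycles_i _ _ _ _⟩
  refine ⟨-z, ?_, by rw [Preadditive.neg_comp, hz]⟩
  have := mono_cyclesMap_inr φ i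
  rw [← hz, Category.assoc, iCycles_toConeCycles, ← Category.assoc,
    ← Preadditive.add_comp] at hk
  rw [Preadditive.neg_comp, neg_eq_iff_add_eq_zero, add_comm]
  exact (Preadditive.mono_iff_cancel_zero _).1 this _ _ hk

/-- The cycles of a mapping cone are a pushout. -/
lemma shortExact_cone_pushout (hK : K.Acyclic) (m i : ℤ) (hmi : m + 1 = i) :
    (ShortComplex.mk (biprod.lift (HomologicalComplex.cyclesMap φ i) (-K.iCycles i))
      (biprod.desc (HomologicalComplex.cyclesMap (mappingCone.inr φ) i) (toConeCycles φ m i hmi))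
      (by rw [biprod.lift_desc, Preadditive.neg_comp, iCycles_toConeCycles,
        add_neg_cancel])).ShortExact where
  mono_f := by
    refine Preadditive.mono_of_cancel_zero _ fun g hg => ?_
    have h := hg =≫ biprod.snd
    rw [← cancel_mono (K.iCycles i), zero_comp, ← neg_eq_zero]
    simpa using h
  epi_g := by
    have hS := shortExact_coneCycles φ hK i (i + 1) rfl
    have := hS.epi_g
    refine Preadditive.epi_of_cancel_zero _ fun g hg => ?_
    have h₁ := biprod.inl ≫= hg
    have h₂ := biprod.inr ≫= hg
    simp only [biprod.inl_desc_assoc, biprod.inr_desc_assoc, comp_zero] at h₁ h₂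
    -- Since `g` vanishes on Z^i(L), it factors through Z^{i+1}(K). The factor is killed by the
    -- epimorphism K^i ⟶ Z^{i+1}(K), because `g` vanishes on K^i as well.
    have h₃ := hS.exact.g_desc g h₁
    dsimp at h₃
    have := epi_toCycles hK i (i + 1) rfl
    have h₄ : hS.exact.desc g h₁ = 0 := by
      rw [← h₃, ← Category.assoc, toConeCycles_coneCyclesFst, Preadditive.neg_comp,
        neg_eq_zero] at h₂
      rw [← cancel_epi (K.toCycles i (i + 1)), comp_zero]
      exact h₂
    rw [← h₃, h₄, comp_zero]
  exact := by
    have hm : Mono (biprod.lift (HomologicalComplex.cyclesMap φ i) (-K.iCycles i)) := by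
      refine Preadditive.mono_of_cancel_zero _ fun g hg => ?_
      have h := hg =≫ biprod.snd
      rw [← cancel_mono (K.iCycles i), zero_comp, ← neg_eq_zero]
      simpa using h
    apply ShortComplex.exact_of_f_is_kernel
    refine KernelFork.IsLimit.ofι' _ _ fun {B} k hk => ?_
    have h := exists_cyclesMap_lift φ m i hmi (k ≫ biprod.fst) (k ≫ biprod.snd) (by
      rw [Category.assoc, Category.assoc, ← Preadditive.comp_add, ← biprod.desc_eq]
      exact hk)
    refine ⟨h.choose, ?_⟩
    apply biprod.hom_ext
    · simpa using h.choose_spec.1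
    · simp [h.choose_spec.2]

/-- The cocycle condition in the cone, written in its two coordinates. It is used to map a given
extension into the cycles of a cone. -/
lemma exists_coneCycles_lift (i j : ℤ) (hij : i + 1 = j) {B : A} (z : B ⟶ K.cycles j)
    (x : B ⟶ L.X i) (h : z ≫ K.iCycles j ≫ φ.f j + x ≫ L.d i j = 0) :
    ∃ y : B ⟶ (mappingCone φ).cycles i, y ≫ coneCyclesFst φ i j hij = z ∧
      y ≫ (mappingCone φ).iCycles i ≫ (mappingCone.snd φ).v i i (add_zero i) = x := by
  refine ⟨(mappingCone φ).liftCycles ((z ≫ K.iCycles j) ≫ (mappingCone.inl φ).v j i (by lia) +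
    x ≫ (mappingCone.inr φ).f i) j (by simp [hij]) ?_, ?_, ?_⟩
  · rw [Preadditive.add_comp, Category.assoc, Category.assoc,
      mappingCone.inl_v_d φ j i (j + 1) (by lia) (by lia), Category.assoc x,
      mappingCone.inr_f_d, Preadditive.comp_sub, Preadditive.comp_sub, HomologicalComplex.iCycles_d_assoc,
      zero_comp, comp_zero, sub_zero]
    simpa only [Preadditive.add_comp, Category.assoc, zero_comp] using h =≫ (mappingCone.inr φ).f j
  · rw [← cancel_mono (K.iCycles j)]
    simp
  · simp

@[simp]
lemma cyclesMap_inr_iCycles_snd (i : ℤ) : HomologicalComplex.cyclesMap (mappingCone.inr φ) i ≫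
    (mappingCone φ).iCycles i ≫ (mappingCone.snd φ).v i i (add_zero i) = L.iCycles i := by
  simp

lemma coneCycles_hom_ext (i j : ℤ) (hij : i + 1 = j) {B : A} {f g : B ⟶ (mappingCone φ).cycles i}
    (h₁ : f ≫ coneCyclesFst φ i j hij = g ≫ coneCyclesFst φ i j hij)
    (h₂ : f ≫ (mappingCone φ).iCycles i ≫ (mappingCone.snd φ).v i i (add_zero i) =
      g ≫ (mappingCone φ).iCycles i ≫ (mappingCone.snd φ).v i i (add_zero i)) : f = g := by
  rw [← cancel_mono ((mappingCone φ).iCycles i), mappingCone.ext_to_iff φ i j hij]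
  have h := h₁ =≫ K.iCycles j
  rw [Category.assoc, coneCyclesFst_iCycles, Category.assoc, coneCyclesFst_iCycles] at h
  exact ⟨by simpa only [Category.assoc] using h, by simpa only [Category.assoc] using h₂⟩

end ConeCycles

/-! ### Degree zero cycles as an equivalence onto the stable category -/

section CyclesEquivalence

variable {A : Type u} [Category.{v} A] [Abelian A] [HasExt.{w} A] {W : ObjectProperty A}

instance full_toKTac : (toKTac.{w} W).Full where
  map_surjective {T T'} f := by
    obtain ⟨φ, hφ⟩ := (HomotopyCategory.quotient A (ComplexShape.up ℤ)).map_surjective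
      (X := T.obj) (Y := T'.obj) f.hom
    exact ⟨ObjectProperty.homMk φ, by ext; exact hφ⟩

/-- The totally acyclic complex underlying an object of the homotopy category. -/
abbrev complexOf (K : KTac.{w} W) : Tac.{w} W := ⟨K.obj.as, K.property⟩

lemma toKTac_map_surjective {K K' : KTac.{w} W} (f : K ⟶ K') :
    ∃ φ : complexOf K ⟶ complexOf K', (toKTac W).map φ = f :=
  (toKTac W).map_surjective (X := complexOf K) (Y := complexOf K') f

variable [IsSelfOrthogonal.{w} W]

lemma IsTotallyAcyclic.gorenstein_cycles {T : CochainComplex A ℤ}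
    (hT : IsTotallyAcyclic.{w} W T) (n : ℤ) : gorenstein.{w} W (T.cycles n) :=
  ⟨T⟦n⟧, hT.shift n, ⟨cyclesShiftIso _ _ _ _ (by simp)⟩⟩

variable [W.ContainsZero] [W.IsClosedUnderIsomorphisms]

instance full_stableCyclesZero [W.IsClosedUnderBinaryProducts] : (stableCyclesZero.{w} W).Full where
  map_surjective {K K'} f := by
    obtain ⟨g, rfl⟩ := (toStable (gorenstein.{w} W)).map_surjective
      (X := (cyclesZero W).obj (complexOf K)) (Y := (cyclesZero W).obj (complexOf K')) f
    obtain ⟨φ, rfl⟩ := (cyclesZero W).map_surjective g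
    exact ⟨(toKTac W).map φ, rfl⟩

instance faithful_stableCyclesZero [W.IsClosedUnderBinaryProducts] :
    (stableCyclesZero.{w} W).Faithful where
  map_injective {K K'} f g h := by
    obtain ⟨φ, rfl⟩ := toKTac_map_surjective f
    obtain ⟨ψ, rfl⟩ := toKTac_map_surjective g
    obtain ⟨H⟩ := nonempty_homotopy_of_stableRel ((Quotient.functor_map_eq_iff _ _ _).1 h)
    ext
    exact HomotopyCategory.eq_of_homotopy _ _ H

instance essSurj_stableCyclesZero : (stableCyclesZero.{w} W).EssSurj where
  mem_essImage M := by
    obtain ⟨T, hT, ⟨e⟩⟩ := M.as.property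
    exact ⟨(toKTac W).obj ⟨T, hT⟩, ⟨(toStable _).mapIso (ObjectProperty.isoMk _ e)⟩⟩

instance additive_cyclesZero : (cyclesZero.{w} W).Additive where
  map_add {T T' f g} := by
    ext
    exact (HomologicalComplex.cyclesFunctor A (ComplexShape.up ℤ) 0).map_add

instance additive_stableCyclesZero [W.IsClosedUnderBinaryProducts] :
    (stableCyclesZero.{w} W).Additive where
  map_add {K K' f g} := by
    obtain ⟨φ, rfl⟩ := toKTac_map_surjective f
    obtain ⟨ψ, rfl⟩ := toKTac_map_surjective g
    exact (congrArg _ ((cyclesZero W).map_add (f := φ) (g := ψ))).trans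
      ((toStable (gorenstein.{w} W)).map_add)

instance isEquivalence_stableCyclesZero [W.IsClosedUnderBinaryProducts] :
    (stableCyclesZero.{w} W).IsEquivalence where

end CyclesEquivalence

/-! ### The Frobenius structure on Gorenstein objects -/

section Frobenius

section

variable {A : Type u} [Category.{v} A] [Abelian A]

lemma cyclesShiftIso_inv_iCycles (T : CochainComplex A ℤ) (n i j : ℤ) (h : i + n = j) :
    (cyclesShiftIso T n i j h).inv ≫ (T⟦n⟧).iCycles i =
      T.iCycles j ≫ (shiftXIso T n i j h).inv := by
  rw [Iso.inv_comp_eq, ← Category.assoc, cyclesShiftIso_hom_iCycles, Category.assoc,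
    Iso.hom_inv_id, Category.comp_id]

lemma shiftXIso_inv_d (T : CochainComplex A ℤ) (i j i' j' : ℤ) (hi : i + 1 = i')
    (hj : j + 1 = j') : (shiftXIso T 1 i i' hi).inv ≫ (T⟦(1 : ℤ)⟧).d i j =
      -T.d i' j' ≫ (shiftXIso T 1 j j' hj).inv := by
  subst hi hj
  have h : (T⟦(1 : ℤ)⟧).d i j = -T.d (i + 1) (j + 1) := by
    rw [CochainComplex.shiftFunctor_obj_d', Int.negOnePow_one, Units.neg_smul, one_smul]
  rw [h]
  change 𝟙 (T.X (i + 1)) ≫ (-T.d (i + 1) (j + 1)) = -T.d (i + 1) (j + 1) ≫ 𝟙 (T.X (j + 1))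
  simp

end

variable {A : Type u} [Category.{v} A] [Abelian A] [HasExt.{w} A] {W : ObjectProperty A}
  [IsSelfOrthogonal.{w} W] [W.ContainsZero] [W.IsClosedUnderIsomorphisms]

lemma exists_conflation_to (M : Gor.{w} W) : ∃ (K P : Gor.{w} W) (i : K ⟶ P) (p : P ⟶ M)
    (w : i ≫ p = 0), IsConflation (ShortComplex.mk i p w) ∧ W P.obj := by
  obtain ⟨T, hT, ⟨e⟩⟩ := M.property
  refine ⟨⟨T.cycles (-1), hT.gorenstein_cycles _⟩, ⟨T.X (-1), gorenstein_of_prop (hT.prop_X _)⟩,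
    ObjectProperty.homMk (T.iCycles (-1)), ObjectProperty.homMk (T.toCycles (-1) 0 ≫ e.hom),
    by ext; exact iCycles_toCycles_assoc _ _ _ _, ?_, hT.prop_X (-1)⟩
  have : (ShortComplex.mk (T.iCycles (-1)) (T.toCycles (-1) 0 ≫ e.hom) (by simp)).ShortExact :=
    ShortComplex.shortExact_of_iso (S₁ := ShortComplex.mk _ _ (iCycles_toCycles T (-1) 0))
      (ShortComplex.isoMk (Iso.refl _) (Iso.refl _) e (by simp) (by simp))
      (shortExact_cycles hT.acyclic (-1) 0 (by simp))
  exact this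

lemma exists_conflation_from (M : Gor.{w} W) : ∃ (I C : Gor.{w} W) (i : M ⟶ I) (p : I ⟶ C)
    (w : i ≫ p = 0), IsConflation (ShortComplex.mk i p w) ∧ W I.obj := by
  obtain ⟨T, hT, ⟨e⟩⟩ := M.property
  refine ⟨⟨T.X 0, gorenstein_of_prop (hT.prop_X _)⟩, ⟨T.cycles 1, hT.gorenstein_cycles _⟩,
    ObjectProperty.homMk (e.inv ≫ T.iCycles 0), ObjectProperty.homMk (T.toCycles 0 1),
    by
      ext
      exact (Category.assoc _ _ _).trans
        ((congrArg (fun f => e.inv ≫ f) (iCycles_toCycles T 0 1)).trans comp_zero),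
    ?_, hT.prop_X 0⟩
  have : (ShortComplex.mk (e.inv ≫ T.iCycles 0) (T.toCycles 0 1) (by simp)).ShortExact :=
    ShortComplex.shortExact_of_iso (S₁ := ShortComplex.mk _ _ (iCycles_toCycles T 0 1))
      (ShortComplex.isoMk e (Iso.refl _) (Iso.refl _) (by simp) (by simp))
      (shortExact_cycles hT.acyclic 0 1 (by simp))
  exact this

/-- Take K and L with Z^0(K) ≅ X₁ and Z^0(L) ≅ X₃. The extension is classified by a map X₃ ⟶ Z^1(K),
which lifts to a chain map φ : L ⟶ K[1]. Then Z^{-1}(cone φ) is again an extension of Z^0(L) by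
Z^0(K), and the five lemma identifies it with X₂. -/
instance isClosedUnderExtensions_gorenstein [W.IsClosedUnderBinaryProducts] :
    (gorenstein.{w} W).IsClosedUnderExtensions where
  prop_X₂_of_shortExact {S} hS h₁ h₃ := by
    obtain ⟨K, hK, ⟨a⟩⟩ := h₁
    obtain ⟨L, hL, ⟨c⟩⟩ := h₃
    have h₄ := hL.subsingleton_ext (hK.prop_X 0)
    have h₅ : Subsingleton (Abelian.Ext.{w} S.X₃ (K.X 0) 1) :=
      subsingleton_ext_of_retract_left c.inv c.hom c.inv_hom_id
    -- The inclusion X₁ ≅ Z^0(K) ⟶ K^0 extends to X₂ since Ext¹(X₃, K^0) = 0. The map induced on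
    -- quotients is the classifying map `h`.
    obtain ⟨e, he⟩ := exists_extension_of_ext hS h₅ (a.inv ≫ K.iCycles 0)
    have := hS.epi_g
    have := hS.mono_f
    have hw : S.f ≫ e ≫ K.toCycles 0 1 = 0 := by
      rw [reassoc_of% he, iCycles_toCycles, comp_zero]
    obtain ⟨h, hh⟩ : ∃ h : S.X₃ ⟶ K.cycles 1, S.g ≫ h = e ≫ K.toCycles 0 1 :=
      ⟨hS.exact.desc _ hw, hS.exact.g_desc _ hw⟩
    obtain ⟨φ, hφ⟩ := hL.exists_cyclesMap_eq (hK.shift 1)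
      (c.hom ≫ h ≫ (cyclesShiftIso K 1 0 1 (by simp)).inv)
    let b := shiftXIso K 1 (-1) 0 (by simp)
    have hL₀ : L.iCycles 0 ≫ φ.f 0 = (c.hom ≫ h) ≫ K.iCycles 1 ≫
        (shiftXIso K 1 0 1 (by simp)).inv := by
      rw [← HomologicalComplex.cyclesMap_i, hφ]
      simp only [Category.assoc]
      rw [cyclesShiftIso_inv_iCycles]
    have h₆ := shiftXIso_inv_d K (-1) 0 0 1 (by simp) (by simp)
    -- The differential of K[1] is -d, so `S.g ≫ h = e ≫ d` becomes exactly the vanishing sum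
    -- required of a cycle in the cone.
    obtain ⟨y, hy₁, hy₂⟩ := exists_coneCycles_lift φ (-1) 0 (by simp) (S.g ≫ c.inv) (e ≫ b.inv) (by
      simp only [b, Category.assoc, hL₀, h₆, c.inv_hom_id_assoc, reassoc_of% hh, K.toCycles_i_assoc,
        Preadditive.comp_neg, add_neg_cancel])
    let Ψ : S ⟶ ShortComplex.mk _ _ (cyclesMap_inr_coneCyclesFst φ (-1) 0 (by simp)) :=
      { τ₁ := a.inv ≫ (cyclesShiftIso K 1 (-1) 0 (by simp)).inv
        τ₂ := y
        τ₃ := c.inv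
        comm₁₂ := by
          dsimp
          apply coneCycles_hom_ext φ (-1) 0 (by simp)
          · rw [Category.assoc, cyclesMap_inr_coneCyclesFst, Category.assoc S.f, hy₁, comp_zero,
              ← Category.assoc, S.zero, zero_comp]
          · simp only [Category.assoc]
            rw [hy₂, cyclesMap_inr_iCycles_snd, cyclesShiftIso_inv_iCycles, reassoc_of% he]
        comm₂₃ := by
          exact hy₁ }
    have : IsIso Ψ.τ₁ := by dsimp [Ψ]; infer_instance
    have : IsIso Ψ.τ₃ := by dsimp [Ψ]; infer_instance
    have := ShortComplex.isIso₂_of_shortExact_of_isIso₁₃ Ψ hS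
      (shortExact_coneCycles φ hL.acyclic (-1) 0 (by simp))
    exact ⟨_, (hL.mappingCone (hK.shift 1) φ).shift (-1),
      ⟨cyclesShiftIso _ (-1) 0 (-1) (by simp) ≪≫ (asIso Ψ.τ₂).symm⟩⟩

lemma isFrobenius_gorenstein [W.IsClosedUnderBinaryProducts] :
    IsFrobenius (gorenstein.{w} W) where
  isClosedUnderExtensions := inferInstance
  enough_projectives M := by
    obtain ⟨K, P, i, p, w, h, hP⟩ := exists_conflation_to M
    exact ⟨K, P, i, p, w, h, isRelProjective_of_prop P hP⟩
  enough_injectives M := by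
    obtain ⟨I, K, i, p, w, h, hI⟩ := exists_conflation_from M
    exact ⟨I, K, i, p, w, h, isRelInjective_of_prop I hI⟩
  isRelProjective_iff M := by
    -- A relative projective is a retract of the middle term of a conflation onto it, which lies in
    -- W and so is relatively injective as well. The converse is dual.
    constructor
    · intro hM
      obtain ⟨K, P, i, p, w, h, hP⟩ := exists_conflation_to M
      obtain ⟨s, hs⟩ := hM _ h (𝟙 M)
      intro S hS f
      obtain ⟨g, hg⟩ := isRelInjective_of_prop P hP S hS (f ≫ s)
      exact ⟨g ≫ p, by rw [reassoc_of% hg]; exact (congrArg (f ≫ ·) hs).trans (Category.comp_id f)⟩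
    · intro hM
      obtain ⟨I, K, i, p, w, h, hI⟩ := exists_conflation_from M
      obtain ⟨r, hr⟩ := hM _ h (𝟙 M)
      intro S hS f
      obtain ⟨g, hg⟩ := isRelProjective_of_prop I hI S hS (r ≫ f)
      exact ⟨i ≫ g, by rw [Category.assoc, hg, ← Category.assoc]; exact
        (congrArg (· ≫ f) hr).trans (Category.id_comp f)⟩

end Frobenius

/-! ### Cosyzygies in the stable category -/

section Cosyzygy

variable {A : Type u} [Category.{v} A] [Abelian A] {G : ObjectProperty A}

lemma IsConflation.epi {S : ShortComplex G.FullSubcategory} (hS : IsConflation S) : Epi S.g where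
  left_cancellation a b h := by
    have := hS.epi_g
    ext
    exact (cancel_epi (S.map G.ι).g).1 (congrArg (fun f => f.hom) h)

lemma IsConflation.exists_desc {S : ShortComplex G.FullSubcategory} (hS : IsConflation S)
    {Z : G.FullSubcategory} (a : S.X₂ ⟶ Z) (h : S.f ≫ a = 0) : ∃ b : S.X₃ ⟶ Z, S.g ≫ b = a := by
  have := hS.epi_g
  have h' : (S.map G.ι).f ≫ a.hom = 0 := congrArg (fun f => f.hom) h
  exact ⟨ObjectProperty.homMk (hS.exact.desc a.hom h'), by ext; exact hS.exact.g_desc _ h'⟩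

/-- A conflation whose middle term is projective and injective. -/
structure IsCosyzygy (S : ShortComplex G.FullSubcategory) : Prop where
  isConflation : IsConflation S
  isRelProjective : IsRelProjective S.X₂
  isRelInjective : IsRelInjective S.X₂

lemma IsConflation.exists_hom {S S' : ShortComplex G.FullSubcategory} (hS : IsConflation S)
    (hS' : IsRelInjective S'.X₂) (a : S.X₁ ⟶ S'.X₁) : ∃ φ : S ⟶ S', φ.τ₁ = a := by
  obtain ⟨b, hb⟩ := hS' S hS (a ≫ S'.f)
  obtain ⟨c, hc⟩ := hS.exists_desc (b ≫ S'.g) (by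
    rw [reassoc_of% hb, S'.zero, comp_zero])
  exact ⟨{ τ₁ := a, τ₂ := b, τ₃ := c, comm₁₂ := hb.symm, comm₂₃ := hc.symm }, rfl⟩

lemma exists_hom_of_stable {S S' : ShortComplex G.FullSubcategory} (hS : IsConflation S)
    (hS' : IsCosyzygy S') (u : (toStable G).obj S.X₁ ⟶ (toStable G).obj S'.X₁) :
    ∃ φ : S ⟶ S', (toStable G).map φ.τ₁ = u := by
  obtain ⟨φ, hφ⟩ := hS.exists_hom hS'.isRelInjective ((toStable G).preimage u)
  exact ⟨φ, by rw [hφ, Functor.map_preimage]⟩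

variable [G.ContainsZero] [G.IsClosedUnderBinaryProducts]

lemma toStable_map_eq_iff {X Y : G.FullSubcategory} (f g : X ⟶ Y) :
    (toStable G).map f = (toStable G).map g ↔ stableRel G f g :=
  Quotient.functor_map_eq_iff _ _ _

/-- The stable class on cokernels depends only on the stable class on the first terms. If the
difference of the `τ₁` factors through an injective P, its first factor extends over S.X₂.
Subtracting this correction from the difference of the `τ₂` leaves a map factoring through S.X₃,
which shows that the difference of the `τ₃` factors through S'.X₂. -/
lemma toStable_map_τ₃_eq {S S' : ShortComplex G.FullSubcategory} (hS : IsConflation S)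
    (hS' : IsCosyzygy S') (φ ψ : S ⟶ S')
    (h : (toStable G).map φ.τ₁ = (toStable G).map ψ.τ₁) :
    (toStable G).map φ.τ₃ = (toStable G).map ψ.τ₃ := by
  rw [toStable_map_eq_iff] at h ⊢
  obtain ⟨P, a, b, -, hP, e⟩ := h
  obtain ⟨a', ha'⟩ := hP S hS a
  obtain ⟨c, hc⟩ := hS.exists_desc (φ.τ₂ - ψ.τ₂ - a' ≫ b ≫ S'.f) (by
    rw [Preadditive.comp_sub, Preadditive.comp_sub, ← φ.comm₁₂, ← ψ.comm₁₂, reassoc_of% ha',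
      ← Preadditive.sub_comp, e, Category.assoc, sub_self])
  refine ⟨S'.X₂, c, S'.g, hS'.isRelProjective, hS'.isRelInjective, ?_⟩
  have := hS.epi
  rw [← cancel_epi S.g, reassoc_of% hc, Preadditive.comp_sub, Preadditive.sub_comp,
    Preadditive.sub_comp, φ.comm₂₃, ψ.comm₂₃]
  simp

/-- The stable morphism induced on cokernels. -/
noncomputable def cosyzygyMap {S S' : ShortComplex G.FullSubcategory} (hS : IsConflation S)
    (hS' : IsCosyzygy S') (u : (toStable G).obj S.X₁ ⟶ (toStable G).obj S'.X₁) :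
    (toStable G).obj S.X₃ ⟶ (toStable G).obj S'.X₃ :=
  (toStable G).map (hS.exists_hom hS'.isRelInjective ((toStable G).preimage u)).choose.τ₃

lemma cosyzygyMap_eq {S S' : ShortComplex G.FullSubcategory} (hS : IsConflation S)
    (hS' : IsCosyzygy S') {u : (toStable G).obj S.X₁ ⟶ (toStable G).obj S'.X₁} (φ : S ⟶ S')
    (h : (toStable G).map φ.τ₁ = u) : cosyzygyMap hS hS' u = (toStable G).map φ.τ₃ := by
  refine toStable_map_τ₃_eq hS hS' _ φ ?_
  rw [h, (hS.exists_hom hS'.isRelInjective ((toStable G).preimage u)).choose_spec,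
    Functor.map_preimage]

lemma cosyzygyMap_comp {S S' S'' : ShortComplex G.FullSubcategory} (hS : IsConflation S)
    (hS' : IsCosyzygy S') (hS'' : IsCosyzygy S'')
    (u : (toStable G).obj S.X₁ ⟶ (toStable G).obj S'.X₁)
    (u' : (toStable G).obj S'.X₁ ⟶ (toStable G).obj S''.X₁) :
    cosyzygyMap hS hS' u ≫ cosyzygyMap hS'.isConflation hS'' u' =
      cosyzygyMap hS hS'' (u ≫ u') := by
  obtain ⟨φ, rfl⟩ := exists_hom_of_stable hS hS' u
  obtain ⟨ψ, rfl⟩ := exists_hom_of_stable hS'.isConflation hS'' u'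
  rw [cosyzygyMap_eq hS hS' φ rfl, cosyzygyMap_eq hS'.isConflation hS'' ψ rfl,
    cosyzygyMap_eq hS hS'' (φ ≫ ψ) (Functor.map_comp _ _ _), ← Functor.map_comp]
  rfl

lemma cosyzygyMap_id {S : ShortComplex G.FullSubcategory} (hS : IsCosyzygy S) :
    cosyzygyMap hS.isConflation hS (𝟙 _) = 𝟙 _ := by
  rw [cosyzygyMap_eq hS.isConflation hS (𝟙 S) ((toStable G).map_id _)]
  exact (toStable G).map_id _

/-- The stable isomorphism induced on cokernels. -/
@[simps]
noncomputable def cosyzygyIso {S S' : ShortComplex G.FullSubcategory} (hS : IsCosyzygy S)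
    (hS' : IsCosyzygy S') (u : (toStable G).obj S.X₁ ≅ (toStable G).obj S'.X₁) :
    (toStable G).obj S.X₃ ≅ (toStable G).obj S'.X₃ where
  hom := cosyzygyMap hS.isConflation hS' u.hom
  inv := cosyzygyMap hS'.isConflation hS u.inv
  hom_inv_id := by rw [cosyzygyMap_comp, u.hom_inv_id, cosyzygyMap_id]
  inv_hom_id := by rw [cosyzygyMap_comp, u.inv_hom_id, cosyzygyMap_id]

end Cosyzygy

/-! ### The shift of complexes as a cosyzygy of cycles -/

section Suspension

lemma comp_square {C : Type*} [Category* C] {X Y Z X' Y' Z' : C} {f : X ⟶ Y} {g : Y ⟶ Z}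
    {f' : X' ⟶ Y'} {g' : Y' ⟶ Z'} {x : X ⟶ X'} {y : Y ⟶ Y'} {z : Z ⟶ Z'}
    (h : x ≫ f' = f ≫ y) (h' : y ≫ g' = g ≫ z) : x ≫ f' ≫ g' = (f ≫ g) ≫ z := by
  rw [reassoc_of% h, h', Category.assoc]

section

variable {A : Type u} [Category.{v} A] [Abelian A]

lemma shiftXIso_inv_naturality {T T' : CochainComplex A ℤ} (φ : T ⟶ T') (n i j : ℤ)
    (h : i + n = j) : (shiftXIso T n i j h).inv ≫ (φ⟦n⟧').f i =
      φ.f j ≫ (shiftXIso T' n i j h).inv := by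
  subst h
  exact (Category.id_comp _).trans (Category.comp_id _).symm

/-- The morphism from a term to the cycles of the shifted complex. -/
noncomputable def toShiftCycles (T : CochainComplex A ℤ) : T.X 0 ⟶ (T⟦(1 : ℤ)⟧).cycles 0 :=
  (shiftXIso T 1 (-1) 0 (by simp)).inv ≫ (T⟦(1 : ℤ)⟧).toCycles (-1) 0

@[simp]
lemma toShiftCycles_iCycles (T : CochainComplex A ℤ) :
    toShiftCycles T ≫ (T⟦(1 : ℤ)⟧).iCycles 0 =
      -T.d 0 1 ≫ (shiftXIso T 1 0 1 (by simp)).inv := by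
  rw [toShiftCycles, Category.assoc, HomologicalComplex.toCycles_i, shiftXIso_inv_d]

@[simp]
lemma iCycles_toShiftCycles (T : CochainComplex A ℤ) : T.iCycles 0 ≫ toShiftCycles T = 0 := by
  rw [← cancel_mono ((T⟦(1 : ℤ)⟧).iCycles 0), Category.assoc, toShiftCycles_iCycles,
    Preadditive.comp_neg, T.iCycles_d_assoc, zero_comp, neg_zero, zero_comp]

lemma toShiftCycles_naturality {T T' : CochainComplex A ℤ} (φ : T ⟶ T') :
    toShiftCycles T ≫ HomologicalComplex.cyclesMap (φ⟦(1 : ℤ)⟧') 0 =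
      φ.f 0 ≫ toShiftCycles T' := by
  rw [← cancel_mono ((T'⟦(1 : ℤ)⟧).iCycles 0), Category.assoc, Category.assoc,
    HomologicalComplex.cyclesMap_i, toShiftCycles_iCycles, ← Category.assoc, toShiftCycles_iCycles,
    Preadditive.neg_comp, Preadditive.comp_neg, Category.assoc, shiftXIso_inv_naturality,
    φ.comm_assoc]

/-- This is the cycle sequence of T[1] between degrees -1 and 0, with its first two terms identified
with Z^0(T) and T^0. Ending in Z^0(T[1]) it refers directly to Z₀ of the shift, with the sign of the
shifted differential built in. -/
lemma shortExact_toShiftCycles {T : CochainComplex A ℤ}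
    (hT' : (T⟦(1 : ℤ)⟧).Acyclic) :
    (ShortComplex.mk _ _ (iCycles_toShiftCycles T)).ShortExact :=
  ShortComplex.shortExact_of_iso (S₁ := ShortComplex.mk _ _ (iCycles_toCycles (T⟦(1 : ℤ)⟧) (-1) 0))
    (ShortComplex.isoMk (cyclesShiftIso T 1 (-1) 0 (by simp)) (shiftXIso T 1 (-1) 0 (by simp))
      (Iso.refl _) (cyclesShiftIso_hom_iCycles _ _ _ _ _)
      ((Iso.hom_inv_id_assoc _ _).trans (Category.comp_id _).symm))
    (shortExact_cycles hT' (-1) 0 (by simp))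

end

variable {A : Type u} [Category.{v} A] [Abelian A] [HasExt.{w} A] {W : ObjectProperty A}
  [IsSelfOrthogonal.{w} W]

/-- The shift of a totally acyclic complex. -/
abbrev shiftTac (T : Tac.{w} W) : Tac.{w} W := ⟨T.obj⟦(1 : ℤ)⟧, T.property.shift 1⟩

/-- The shift of a morphism of totally acyclic complexes. -/
abbrev shiftTacMap {T T' : Tac.{w} W} (φ : T ⟶ T') : shiftTac T ⟶ shiftTac T' :=
  ObjectProperty.homMk (φ.hom⟦(1 : ℤ)⟧')

variable [W.ContainsZero] [W.IsClosedUnderIsomorphisms]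

/-- A term of a totally acyclic complex, as a Gorenstein object. -/
abbrev termZero (T : Tac.{w} W) : Gor.{w} W :=
  ⟨T.obj.X 0, gorenstein_of_prop (T.property.prop_X 0)⟩

/-- The conflation from the cycles of a totally acyclic complex to those of its shift. -/
noncomputable abbrev cyclesConflation (T : Tac.{w} W) : ShortComplex (Gor.{w} W) where
  X₁ := (cyclesZero W).obj T
  X₂ := termZero T
  X₃ := (cyclesZero W).obj (shiftTac T)
  f := ObjectProperty.homMk (T.obj.iCycles 0)
  g := ObjectProperty.homMk (toShiftCycles T.obj)
  zero := by ext; exact iCycles_toShiftCycles T.obj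

lemma isCosyzygy_cyclesConflation (T : Tac.{w} W) : IsCosyzygy (cyclesConflation T) where
  isConflation := shortExact_toShiftCycles (T.property.shift 1).acyclic
  isRelProjective := isRelProjective_of_prop _ (T.property.prop_X 0)
  isRelInjective := isRelInjective_of_prop _ (T.property.prop_X 0)

/-- The morphism of conflations induced by a morphism of totally acyclic complexes. -/
noncomputable abbrev cyclesConflationMap {T T' : Tac.{w} W} (φ : T ⟶ T') :
    cyclesConflation T ⟶ cyclesConflation T' where
  τ₁ := (cyclesZero W).map φ
  τ₂ := ObjectProperty.homMk (φ.hom.f 0)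
  τ₃ := (cyclesZero W).map (shiftTacMap φ)
  comm₁₂ := by ext; exact HomologicalComplex.cyclesMap_i φ.hom 0
  comm₂₃ := by ext; exact (toShiftCycles_naturality φ.hom).symm

variable [W.IsClosedUnderBinaryProducts]

/-- The shift of the homotopy category is the shift of complexes. -/
noncomputable def shiftKTacIso (T : Tac.{w} W) :
    ((toKTac W).obj T)⟦(1 : ℤ)⟧ ≅ (toKTac W).obj (shiftTac T) :=
  (homotopyTotallyAcyclic.{w} W).ι.preimageIso
    (((homotopyTotallyAcyclic.{w} W).ι.commShiftIso (1 : ℤ)).app ((toKTac W).obj T) ≪≫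
      ((HomotopyCategory.quotient A (ComplexShape.up ℤ)).commShiftIso (1 : ℤ)).symm.app T.obj)

lemma shiftKTacIso_naturality {T T' : Tac.{w} W} (φ : T ⟶ T') :
    ((toKTac W).map φ)⟦(1 : ℤ)⟧' ≫ (shiftKTacIso T').hom =
      (shiftKTacIso T).hom ≫ (toKTac W).map (shiftTacMap φ) := by
  apply (homotopyTotallyAcyclic.{w} W).ι.map_injective
  have h₁ := (homotopyTotallyAcyclic.{w} W).ι.commShiftIso_hom_naturality
    ((toKTac W).map φ) (1 : ℤ)
  have h₂ := ((HomotopyCategory.quotient A (ComplexShape.up ℤ)).commShiftIso (1 : ℤ)).inv.naturality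
    φ.hom
  rw [Functor.map_comp, Functor.map_comp, shiftKTacIso, shiftKTacIso, Functor.preimageIso_hom,
    Functor.preimageIso_hom, Functor.map_preimage, Functor.map_preimage]
  exact comp_square h₁ h₂

variable [HasShift (StGor.{w} W) ℤ] [(stableCyclesZero.{w} W).CommShift ℤ]

/-- The cycles of a shifted complex are the shift of the cycles in the stable category. -/
noncomputable def stableShiftIso (T : Tac.{w} W) :
    (toStable (gorenstein.{w} W)).obj ((cyclesZero W).obj (shiftTac T)) ≅
      ((toStable (gorenstein.{w} W)).obj ((cyclesZero W).obj T))⟦(1 : ℤ)⟧ :=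
  (stableCyclesZero W).mapIso (shiftKTacIso T).symm ≪≫
    ((stableCyclesZero W).commShiftIso (1 : ℤ)).app ((toKTac W).obj T)

lemma stableShiftIso_naturality {T T' : Tac.{w} W} (φ : T ⟶ T') :
    (toStable (gorenstein.{w} W)).map ((cyclesZero W).map (shiftTacMap φ)) ≫
      (stableShiftIso T').hom = (stableShiftIso T).hom ≫
        ((toStable (gorenstein.{w} W)).map ((cyclesZero W).map φ))⟦(1 : ℤ)⟧' := by
  have h₁ := (stableCyclesZero W).commShiftIso_hom_naturality ((toKTac W).map φ) (1 : ℤ)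
  have h₂ : (shiftKTacIso T).inv ≫ ((toKTac W).map φ)⟦(1 : ℤ)⟧' =
    (toKTac W).map (shiftTacMap φ) ≫ (shiftKTacIso T').inv := by
    rw [Iso.inv_comp_eq, ← Category.assoc, Iso.eq_comp_inv, shiftKTacIso_naturality]
  have h₃ := congrArg (stableCyclesZero W).map h₂
  rw [Functor.map_comp, Functor.map_comp] at h₃
  exact comp_square h₃.symm h₁

end Suspension

/-! ### The natural isomorphism between cosyzygies and the shift, and cone triangles -/

section SuspensionIso

variable {A : Type u} [Category.{v} A] [Abelian A] [HasExt.{w} A] {W : ObjectProperty A}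
  [IsSelfOrthogonal.{w} W] [W.ContainsZero] [W.IsClosedUnderIsomorphisms]
  [W.IsClosedUnderBinaryProducts]

section

variable [HasShift (StGor.{w} W) ℤ] [(stableCyclesZero.{w} W).CommShift ℤ]

/-- The third term of a cosyzygy sequence is the shift of the first one. -/
noncomputable def suspIso {S : ShortComplex (Gor.{w} W)} (hS : IsCosyzygy S) :
    (toStable (gorenstein.{w} W)).obj S.X₃ ≅
      ((toStable (gorenstein.{w} W)).obj S.X₁)⟦(1 : ℤ)⟧ :=
  let R := Classical.arbitrary (CompleteResolutions.{w} W)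
  let e := (toStable (gorenstein.{w} W)).mapIso (R.cyclesIso S.X₁)
  cosyzygyIso hS (isCosyzygy_cyclesConflation (R.complex S.X₁)) e.symm ≪≫
    stableShiftIso (R.complex S.X₁) ≪≫ (shiftFunctor (StGor.{w} W) (1 : ℤ)).mapIso e

/-- Shows that `suspIso` can be computed from any complex T with a stable map from Z^0(T) to S.X₁,
not only from the chosen resolution. Such a map lifts to a chain map into the chosen complex, and
`stableShiftIso` is natural for chain maps. -/
lemma cosyzygyMap_suspIso {S : ShortComplex (Gor.{w} W)} (hS : IsCosyzygy S) (T : Tac.{w} W)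
    (u : (toStable (gorenstein.{w} W)).obj ((cyclesZero W).obj T) ⟶
      (toStable (gorenstein.{w} W)).obj S.X₁) :
    cosyzygyMap (isCosyzygy_cyclesConflation T).isConflation hS u ≫ (suspIso hS).hom =
      (stableShiftIso T).hom ≫ u⟦(1 : ℤ)⟧' := by
  let R := Classical.arbitrary (CompleteResolutions.{w} W)
  let e := (toStable (gorenstein.{w} W)).mapIso (R.cyclesIso S.X₁)
  obtain ⟨ψ, hψ⟩ := (toStable (gorenstein.{w} W)).map_surjective (u ≫ e.inv)
  obtain ⟨φ, rfl⟩ := (cyclesZero W).map_surjective ψ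
  have h₁ : cosyzygyMap (isCosyzygy_cyclesConflation T).isConflation hS u ≫
      cosyzygyMap hS.isConflation (isCosyzygy_cyclesConflation (R.complex S.X₁)) e.inv =
      (toStable (gorenstein.{w} W)).map ((cyclesZero W).map (shiftTacMap φ)) :=
    (cosyzygyMap_comp _ _ _ _ _).trans
      (cosyzygyMap_eq _ (isCosyzygy_cyclesConflation _) (cyclesConflationMap φ) hψ)
  have h₂ := stableShiftIso_naturality φ
  rw [hψ] at h₂
  have h₃ : (u ≫ e.inv)⟦(1 : ℤ)⟧' ≫ e.hom⟦(1 : ℤ)⟧' = u⟦(1 : ℤ)⟧' := by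
    rw [← Functor.map_comp, Category.assoc, e.inv_hom_id, Category.comp_id]
  rw [← h₃, ← Category.assoc, ← h₂, ← h₁, Category.assoc, Category.assoc]
  rfl

lemma suspIso_cyclesConflation (T : Tac.{w} W) :
    (suspIso (isCosyzygy_cyclesConflation T)).hom = (stableShiftIso T).hom := by
  have h := cosyzygyMap_suspIso (isCosyzygy_cyclesConflation T) T (𝟙 _)
  rw [cosyzygyMap_id] at h
  exact (Category.id_comp _).symm.trans (h.trans
    ((congrArg _ ((shiftFunctor (StGor.{w} W) (1 : ℤ)).map_id _)).trans (Category.comp_id _)))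

lemma suspIso_naturality {S S' : ShortComplex (Gor.{w} W)} (hS : IsCosyzygy S)
    (hS' : IsCosyzygy S') (φ : S ⟶ S') :
    (toStable (gorenstein.{w} W)).map φ.τ₃ ≫ (suspIso hS').hom =
      (suspIso hS).hom ≫ ((toStable (gorenstein.{w} W)).map φ.τ₁)⟦(1 : ℤ)⟧' := by
  let R := Classical.arbitrary (CompleteResolutions.{w} W)
  let e := (toStable (gorenstein.{w} W)).mapIso (R.cyclesIso S.X₁)
  -- Precomposing with the comparison from a cycle conflation reduces both sides to the preceding
  -- formula.
  rw [← cancel_epi (cosyzygyIso (isCosyzygy_cyclesConflation (R.complex S.X₁)) hS e).hom,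
    ← cosyzygyMap_eq hS.isConflation hS' φ rfl, cosyzygyIso_hom, ← Category.assoc,
    ← Category.assoc, cosyzygyMap_comp, cosyzygyMap_suspIso, cosyzygyMap_suspIso,
    Functor.map_comp, Category.assoc]

end

lemma map_shiftKTacIso_inv (T : Tac.{w} W) :
    (homotopyTotallyAcyclic.{w} W).ι.map (shiftKTacIso T).inv ≫
      ((homotopyTotallyAcyclic.{w} W).ι.commShiftIso (1 : ℤ)).hom.app ((toKTac W).obj T) =
    ((HomotopyCategory.quotient A (ComplexShape.up ℤ)).commShiftIso (1 : ℤ)).hom.app T.obj := by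
  rw [shiftKTacIso, Functor.preimageIso_inv, Functor.map_preimage]
  exact (Category.assoc _ _ _).trans ((congrArg _ (Iso.inv_hom_id_app _ _)).trans
    (Category.comp_id _))

section ConeTriangle

variable {K L : Tac.{w} W} (φ : K ⟶ L)

/-- The mapping cone of a morphism of totally acyclic complexes. -/
noncomputable abbrev coneTac : Tac.{w} W :=
  ⟨CochainComplex.mappingCone φ.hom, K.property.mappingCone L.property φ.hom⟩

/-- The morphism from the target to the mapping cone. -/
noncomputable abbrev coneTacInr : L ⟶ coneTac φ :=
  ObjectProperty.homMk (CochainComplex.mappingCone.inr φ.hom)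

/-- The morphism from the mapping cone to the shift of the source. -/
noncomputable abbrev coneTacDelta : coneTac φ ⟶ shiftTac K :=
  ObjectProperty.homMk (CochainComplex.mappingCone.triangle φ.hom).mor₃

/-- The standard triangle of a morphism of totally acyclic complexes. -/
noncomputable abbrev coneTriangle : Triangle (KTac.{w} W) :=
  Triangle.mk ((toKTac W).map φ) ((toKTac W).map (coneTacInr φ))
    ((toKTac W).map (coneTacDelta φ) ≫ (shiftKTacIso K).inv)

lemma coneTriangle_distinguished : coneTriangle φ ∈ distTriang (KTac.{w} W) := by
  change (homotopyTotallyAcyclic.{w} W).ι.mapTriangle.obj (coneTriangle φ) ∈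
    distTriang (HomotopyCategory A (ComplexShape.up ℤ))
  refine isomorphic_distinguished _
    (HomotopyCategory.mappingCone_triangleh_distinguished φ.hom) _ ?_
  refine Triangle.isoMk _ _ (Iso.refl _) (Iso.refl _) (Iso.refl _) ?_ ?_ ?_
  · exact (Category.comp_id _).trans (Category.id_comp _).symm
  · exact (Category.comp_id _).trans (Category.id_comp _).symm
  · refine ((congrArg _ ((shiftFunctor _ (1 : ℤ)).map_id _)).trans (Category.comp_id _)).trans
      (Eq.trans ?_ (Category.id_comp _).symm)
    refine (congrArg (· ≫ _) ((homotopyTotallyAcyclic.{w} W).ι.map_comp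
      ((toKTac W).map (coneTacDelta φ)) (shiftKTacIso K).inv)).trans
      ((Category.assoc _ _ _).trans (congrArg _ (map_shiftKTacIso_inv K)))

/-- A distinguished triangle is determined up to isomorphism by its first map, and that map is
represented by a chain map. -/
lemma exists_iso_coneTriangle (T : Triangle (KTac.{w} W)) (hT : T ∈ distTriang (KTac.{w} W)) :
    ∃ (K L : Tac.{w} W) (φ : K ⟶ L), Nonempty (T ≅ coneTriangle φ) := by
  obtain ⟨φ, hφ⟩ := toKTac_map_surjective T.mor₁
  exact ⟨_, _, φ, ⟨isoTriangleOfIso₁₂ _ _ hT (coneTriangle_distinguished φ) (Iso.refl _)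
    (Iso.refl _) ((Category.comp_id _).trans (hφ.symm.trans (Category.id_comp _).symm))⟩⟩

end ConeTriangle

end SuspensionIso

/-! ### Comparison with the usual triangulation of a stable category -/

section StandardTriangulation

section

variable {A : Type u} [Category.{v} A] [Abelian A]

lemma toCycles_cyclesMap {T T' : CochainComplex A ℤ} (φ : T ⟶ T') (i j : ℤ) :
    φ.f i ≫ T'.toCycles i j = T.toCycles i j ≫ HomologicalComplex.cyclesMap φ j := by
  rw [← cancel_mono (T'.iCycles j)]
  simp

lemma lift_desc_coneCycles_eq_zero {K L : CochainComplex A ℤ} (φ : K ⟶ L) (m i : ℤ)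
    (hmi : m + 1 = i) : biprod.lift (HomologicalComplex.cyclesMap φ i) (-K.iCycles i) ≫
      biprod.desc (HomologicalComplex.cyclesMap (CochainComplex.mappingCone.inr φ) i)
        (toConeCycles φ m i hmi) = 0 := by
  rw [biprod.lift_desc, Preadditive.neg_comp, iCycles_toConeCycles, add_neg_cancel]

/-- The connecting map of the cone kills L, and on K^0 it is minus the canonical map to Z^0(K[1]).
The two hypotheses are all that is needed about the connecting map. -/
lemma desc_coneCycles_cyclesMap {K L : CochainComplex A ℤ} (φ : K ⟶ L)
    (δ : CochainComplex.mappingCone φ ⟶ K⟦(1 : ℤ)⟧)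
    (h : CochainComplex.mappingCone.inr φ ≫ δ = 0)
    (h' : (CochainComplex.mappingCone.inl φ).v 0 (-1) (by simp) ≫ δ.f (-1) =
      -(shiftXIso K 1 (-1) 0 (by simp)).inv) :
    biprod.desc (HomologicalComplex.cyclesMap (CochainComplex.mappingCone.inr φ) 0)
      (toConeCycles φ (-1) 0 (by simp)) ≫ HomologicalComplex.cyclesMap δ 0 =
    -(biprod.snd ≫ toShiftCycles K) := by
  apply biprod.hom_ext'
  · rw [biprod.inl_desc_assoc, Preadditive.comp_neg, biprod.inl_snd_assoc, zero_comp, neg_zero,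
      ← HomologicalComplex.cyclesMap_comp, h, HomologicalComplex.cyclesMap_zero]
  · rw [biprod.inr_desc_assoc, Preadditive.comp_neg, biprod.inr_snd_assoc, toConeCycles,
      Category.assoc, ← toCycles_cyclesMap, ← Category.assoc, h', Preadditive.neg_comp,
      toShiftCycles]

end

variable {A : Type u} [Category.{v} A] [Abelian A] [HasExt.{w} A] {W : ObjectProperty A}
  [IsSelfOrthogonal.{w} W] [W.ContainsZero] [W.IsClosedUnderIsomorphisms]
  [W.IsClosedUnderBinaryProducts]

section ConeConflation

/-- The direct sum of the cycles of `L` and of a term of `K`. -/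
noncomputable abbrev coneMid (K L : Tac.{w} W) : Gor.{w} W :=
  ⟨L.obj.cycles 0 ⊞ K.obj.X 0, (gorenstein.{w} W).prop_of_iso (biprod.isoProd _ _).symm
    ((gorenstein.{w} W).prop_prod _ _ ((cyclesZero W).obj L).property (termZero K).property)⟩

section

variable (K L : Tac.{w} W)

/-- The first projection. -/
noncomputable def coneMidFst : coneMid K L ⟶ (cyclesZero W).obj L :=
  ObjectProperty.homMk biprod.fst

/-- The second projection. -/
noncomputable def coneMidSnd : coneMid K L ⟶ termZero K :=
  ObjectProperty.homMk biprod.snd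

/-- The first inclusion. -/
noncomputable def coneMidInl : (cyclesZero W).obj L ⟶ coneMid K L :=
  ObjectProperty.homMk biprod.inl

/-- The second inclusion. -/
noncomputable def coneMidInr : termZero K ⟶ coneMid K L :=
  ObjectProperty.homMk biprod.inr

lemma coneMidInl_fst : coneMidInl K L ≫ coneMidFst K L = 𝟙 _ := by
  ext; exact biprod.inl_fst

lemma coneMidInr_fst : coneMidInr K L ≫ coneMidFst K L = 0 := by
  ext; exact biprod.inr_fst

lemma coneMid_total :
    coneMidFst K L ≫ coneMidInl K L + coneMidSnd K L ≫ coneMidInr K L = 𝟙 _ := by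
  ext : 1; exact biprod.total

end

variable {K L : Tac.{w} W} (φ : K ⟶ L)

/-- The conflation given by the mapping cone of a morphism of totally acyclic complexes. -/
noncomputable abbrev coneConflation : ShortComplex (Gor.{w} W) where
  X₁ := (cyclesZero W).obj K
  X₂ := coneMid K L
  X₃ := (cyclesZero W).obj (coneTac φ)
  f := ObjectProperty.homMk (biprod.lift (HomologicalComplex.cyclesMap φ.hom 0) (-K.obj.iCycles 0))
  g := ObjectProperty.homMk (biprod.desc
    (HomologicalComplex.cyclesMap (CochainComplex.mappingCone.inr φ.hom) 0)
    (toConeCycles φ.hom (-1) 0 (by simp)))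
  zero := by
    ext : 1
    exact lift_desc_coneCycles_eq_zero φ.hom (-1) 0 (by simp)

lemma isConflation_coneConflation : IsConflation (coneConflation φ) :=
  shortExact_cone_pushout φ.hom K.property.acyclic (-1) 0 (by simp)

lemma coneConflation_f_fst : (coneConflation φ).f ≫ coneMidFst K L = (cyclesZero W).map φ := by
  ext; exact biprod.lift_fst _ _

lemma coneConflation_f_snd :
    (coneConflation φ).f ≫ coneMidSnd K L = -(cyclesConflation K).f := by
  ext; exact biprod.lift_snd _ _

lemma inl_coneConflation_g :
    coneMidInl K L ≫ (coneConflation φ).g = (cyclesZero W).map (coneTacInr φ) := by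
  ext; exact biprod.inl_desc _ _

/-- Together with `coneConflation_f_snd`, this makes (id, -snd, δ) a morphism from the cone
conflation to the cosyzygy conflation of K. So δ is the third map that the usual triangulation
prescribes. -/
lemma coneConflation_g_delta : (coneConflation φ).g ≫ (cyclesZero W).map (coneTacDelta φ) =
    -(coneMidSnd K L ≫ (cyclesConflation K).g) := by
  ext : 1
  refine desc_coneCycles_cyclesMap φ.hom (CochainComplex.mappingCone.triangle φ.hom).mor₃ ?_
    (CochainComplex.mappingCone.inl_v_triangle_mor₃_f φ.hom 0 (-1) (by simp))
  ext p
  exact CochainComplex.mappingCone.inr_f_triangle_mor₃_f φ.hom p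

end ConeConflation

variable [HasShift (StGor.{w} W) ℤ] [(stableCyclesZero.{w} W).CommShift ℤ]

/-- The image of the standard triangle of a morphism in the stable category. -/
noncomputable abbrev stableConeTriangle {K L : Tac.{w} W} (φ : K ⟶ L) : Triangle (StGor.{w} W) :=
  Triangle.mk ((toStable (gorenstein.{w} W)).map ((cyclesZero W).map φ))
    ((toStable (gorenstein.{w} W)).map ((cyclesZero W).map (coneTacInr φ)))
    ((toStable (gorenstein.{w} W)).map ((cyclesZero W).map (coneTacDelta φ)) ≫
      (stableShiftIso K).hom)

/-- The functor `Z₀` sends the standard triangle to its image. -/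
noncomputable def mapTriangleConeTriangleIso {K L : Tac.{w} W} (φ : K ⟶ L) :
    (stableCyclesZero W).mapTriangle.obj (coneTriangle φ) ≅ stableConeTriangle φ := by
  refine Triangle.isoMk _ _ (Iso.refl _) (Iso.refl _) (Iso.refl _) ?_ ?_ ?_
  · exact (Category.comp_id _).trans (Category.id_comp _).symm
  · exact (Category.comp_id _).trans (Category.id_comp _).symm
  · refine ((congrArg _ ((shiftFunctor _ (1 : ℤ)).map_id _)).trans (Category.comp_id _)).trans
      (Eq.trans ?_ (Category.id_comp _).symm)
    exact (congrArg (· ≫ _) ((stableCyclesZero W).map_comp ((toKTac W).map (coneTacDelta φ))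
      (shiftKTacIso K).inv)).trans (Category.assoc _ _ _)

/-- The triangle of the conflation given by a mapping cone. -/
noncomputable def coneConflationTriangleIso {K L : Tac.{w} W} (φ : K ⟶ L) :
    Triangle.mk ((toStable (gorenstein.{w} W)).map (coneConflation φ).f)
      ((toStable (gorenstein.{w} W)).map (coneConflation φ).g)
      ((toStable (gorenstein.{w} W)).map ((cyclesZero W).map (coneTacDelta φ)) ≫
        (suspIso (isCosyzygy_cyclesConflation K)).hom) ≅ stableConeTriangle φ := by
  -- The summand K^0 is projective-injective, hence stably zero, so the middle term is stably
  -- Z^0(L).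
  have h : (toStable (gorenstein.{w} W)).map (coneMidFst K L ≫ coneMidInl K L) =
      (toStable (gorenstein.{w} W)).map (𝟙 (coneMid K L)) := by
    rw [toStable_map_eq_iff]
    refine ⟨termZero K, -coneMidSnd K L, coneMidInr K L,
      (isCosyzygy_cyclesConflation K).isRelProjective,
      (isCosyzygy_cyclesConflation K).isRelInjective, ?_⟩
    rw [← coneMid_total, Preadditive.neg_comp]
    abel
  let e : (toStable (gorenstein.{w} W)).obj (coneMid K L) ≅
      (toStable (gorenstein.{w} W)).obj ((cyclesZero W).obj L) :=
    { hom := (toStable (gorenstein.{w} W)).map (coneMidFst K L)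
      inv := (toStable (gorenstein.{w} W)).map (coneMidInl K L)
      hom_inv_id := (Functor.map_comp _ _ _).symm.trans
        (h.trans ((toStable (gorenstein.{w} W)).map_id _))
      inv_hom_id := (Functor.map_comp _ _ _).symm.trans
        ((congrArg _ (coneMidInl_fst K L)).trans ((toStable (gorenstein.{w} W)).map_id _)) }
  refine Triangle.isoMk _ _ (Iso.refl _) e (Iso.refl _) ?_ ?_ ?_
  · exact ((toStable (gorenstein.{w} W)).map_comp (coneConflation φ).f
      (coneMidFst K L)).symm.trans ((congrArg _ (coneConflation_f_fst φ)).trans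
      (Category.id_comp _).symm)
  · have h' : (toStable (gorenstein.{w} W)).map (coneConflation φ).g =
        (toStable (gorenstein.{w} W)).map
          (coneMidFst K L ≫ (cyclesZero W).map (coneTacInr φ)) := by
      rw [← inl_coneConflation_g, ← Category.assoc, Functor.map_comp, h]
      exact ((congrArg (· ≫ _) ((toStable (gorenstein.{w} W)).map_id _)).trans
        (Category.id_comp _)).symm
    exact (Category.comp_id _).trans (h'.trans ((toStable (gorenstein.{w} W)).map_comp _ _))
  · refine ((congrArg _ ((shiftFunctor _ (1 : ℤ)).map_id _)).trans (Category.comp_id _)).trans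
      (Eq.trans ?_ (Category.id_comp _).symm)
    exact congrArg _ (suspIso_cyclesConflation K)

/-- Lift f to a chain map φ between complete resolutions. The conflation X ⟶ Y ⟶ Z and the cone
conflation of φ differ only by the projective-injective summand K^0, so Z and Z^0(cone φ) are stably
isomorphic. The third maps agree because both are induced on cokernels by the same map on first
terms. -/
lemma nonempty_iso_stableConeTriangle {X Y Z I C : Gor.{w} W} {f : X ⟶ Y} {g : Y ⟶ Z}
    {i : X ⟶ I} {p : I ⟶ C} {w : f ≫ g = 0} {w' : i ≫ p = 0} {j : Y ⟶ I} {k : Z ⟶ C}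
    (hS : IsConflation (ShortComplex.mk f g w)) (hS' : IsCosyzygy (ShortComplex.mk i p w'))
    (hj : f ≫ j = i) (hk : g ≫ k = j ≫ p) :
    ∃ (K L : Tac.{w} W) (φ : K ⟶ L), Nonempty (Triangle.mk
      ((toStable (gorenstein.{w} W)).map f) ((toStable (gorenstein.{w} W)).map g)
      ((toStable (gorenstein.{w} W)).map k ≫ (suspIso hS').hom) ≅ stableConeTriangle φ) := by
  let R := Classical.arbitrary (CompleteResolutions.{w} W)
  let K := R.complex X
  let L := R.complex Y
  let eX : (cyclesZero W).obj K ≅ X := R.cyclesIso X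
  let eY : (cyclesZero W).obj L ≅ Y := R.cyclesIso Y
  have hK := isCosyzygy_cyclesConflation K
  obtain ⟨φ, hφ⟩ := (cyclesZero W).map_surjective (eX.hom ≫ f ≫ eY.inv)
  have hφ' : (cyclesZero W).map φ ≫ eY.hom = eX.hom ≫ f := by simp [hφ]
  have hφ'' : eX.inv ≫ (cyclesZero W).map φ = f ≫ eY.inv := by simp [hφ]
  have hG := isConflation_coneConflation φ
  have epiG := hG.epi
  have epig := hS.epi
  dsimp only at epig
  obtain ⟨r, hr⟩ := hG.exists_desc (coneMidFst K L ≫ eY.hom ≫ g) (by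
    rw [← Category.assoc, coneConflation_f_fst, reassoc_of% hφ', w, comp_zero])
  obtain ⟨j', hj'⟩ := hK.isRelInjective _ hS (eX.inv ≫ (cyclesConflation K).f)
  dsimp only at hj' r hr
  -- Here `j'` extends X ⟶ K^0 along `f`. The correction term in K^0, with its sign, makes `s₂`
  -- compatible with the first map of the cone conflation.
  let s₂ : Y ⟶ coneMid K L := eY.inv ≫ coneMidInl K L - j' ≫ coneMidInr K L
  have hs₂ : f ≫ s₂ = eX.inv ≫ (coneConflation φ).f := by
    rw [← Category.comp_id (coneConflation φ).f, ← coneMid_total K L, Preadditive.comp_add,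
      ← Category.assoc (coneConflation φ).f, ← Category.assoc (coneConflation φ).f,
      coneConflation_f_fst, coneConflation_f_snd, Preadditive.comp_add, reassoc_of% hφ'',
      Preadditive.comp_sub, reassoc_of% hj', Preadditive.neg_comp, Preadditive.comp_neg,
      sub_eq_add_neg]
  have hs₂' : s₂ ≫ coneMidFst K L = eY.inv := by
    rw [Preadditive.sub_comp, Category.assoc, Category.assoc, coneMidInl_fst, coneMidInr_fst,
      Category.comp_id, comp_zero, sub_zero]
  obtain ⟨s, hs⟩ := hS.exists_desc (s₂ ≫ (coneConflation φ).g) (by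
    rw [← Category.assoc, hs₂, Category.assoc, (coneConflation φ).zero, comp_zero])
  dsimp only at s hs
  have hsr : s ≫ r = 𝟙 Z := by
    rw [← cancel_epi g, reassoc_of% hs, hr, ← Category.assoc, hs₂', eY.inv_hom_id_assoc,
      Category.comp_id]
  -- This map measures the failure of `fst ≫ eY ≫ s₂` to be the identity. It vanishes on Z^0(K), so
  -- it descends to the cycles of the cone and factors `r ≫ s - 𝟙` through K^0.
  let q : coneMid K L ⟶ termZero K := coneMidSnd K L + coneMidFst K L ≫ eY.hom ≫ j'
  obtain ⟨q', hq'⟩ := hG.exists_desc q (by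
    rw [Preadditive.comp_add, coneConflation_f_snd, ← Category.assoc, coneConflation_f_fst,
      reassoc_of% hφ', hj', eX.hom_inv_id_assoc, neg_add_cancel])
  dsimp only at q' hq'
  have hrs : (toStable (gorenstein.{w} W)).map (r ≫ s) =
      (toStable (gorenstein.{w} W)).map (𝟙 ((cyclesZero W).obj (coneTac φ))) := by
    rw [toStable_map_eq_iff]
    refine ⟨termZero K, -q', coneMidInr K L ≫ (coneConflation φ).g, hK.isRelProjective,
      hK.isRelInjective, ?_⟩
    rw [← cancel_epi (coneConflation φ).g, Preadditive.comp_sub, Preadditive.neg_comp,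
      Preadditive.comp_neg, reassoc_of% hq', reassoc_of% hr, hs, Category.comp_id]
    have h₁ : coneMidFst K L ≫ eY.hom ≫ s₂ = 𝟙 _ - q ≫ coneMidInr K L := by
      rw [← coneMid_total K L]
      simp only [s₂, q, Preadditive.comp_sub, Preadditive.add_comp, Category.assoc,
        eY.hom_inv_id_assoc]
      abel
    rw [← Category.assoc eY.hom, ← Category.assoc (coneMidFst K L), h₁, Preadditive.sub_comp,
      Category.id_comp, Category.assoc]
    abel
  let e : (toStable (gorenstein.{w} W)).obj ((cyclesZero W).obj (coneTac φ)) ≅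
      (toStable (gorenstein.{w} W)).obj Z :=
    { hom := (toStable (gorenstein.{w} W)).map r
      inv := (toStable (gorenstein.{w} W)).map s
      hom_inv_id := (Functor.map_comp _ _ _).symm.trans
        (hrs.trans ((toStable (gorenstein.{w} W)).map_id _))
      inv_hom_id := (Functor.map_comp _ _ _).symm.trans
        ((congrArg _ hsr).trans ((toStable (gorenstein.{w} W)).map_id _)) }
  obtain ⟨ψ, hψ⟩ := hK.isConflation.exists_hom hS'.isRelInjective eX.hom
  have hδ : (toStable (gorenstein.{w} W)).map (r ≫ k) =
      (toStable (gorenstein.{w} W)).map ((cyclesZero W).map (coneTacDelta φ) ≫ ψ.τ₃) := by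
    -- Both `α` and `β ≫ ψ` are `eX.hom` on first terms, so their third components are stably equal.
    let α : coneConflation φ ⟶ ShortComplex.mk i p w' :=
      { τ₁ := eX.hom
        τ₂ := coneMidFst K L ≫ eY.hom ≫ j
        τ₃ := r ≫ k
        comm₁₂ := by
          dsimp only
          rw [← Category.assoc, coneConflation_f_fst, reassoc_of% hφ', hj]
        comm₂₃ := by
          dsimp only
          rw [reassoc_of% hr, hk, Category.assoc, Category.assoc] }
    let β : coneConflation φ ⟶ cyclesConflation K :=
      { τ₁ := 𝟙 _
        τ₂ := -coneMidSnd K L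
        τ₃ := (cyclesZero W).map (coneTacDelta φ)
        comm₁₂ := by
          rw [Preadditive.comp_neg, coneConflation_f_snd, neg_neg, Category.id_comp]
        comm₂₃ := by
          rw [coneConflation_g_delta, Preadditive.neg_comp] }
    exact toStable_map_τ₃_eq hG hS' α (β ≫ ψ) (congrArg _ (hψ.symm.trans
      (Category.id_comp _).symm))
  have h₄ := suspIso_naturality hK hS' ψ
  rw [suspIso_cyclesConflation, hψ] at h₄
  refine ⟨K, L, φ, ⟨(Triangle.isoMk _ _ ((toStable (gorenstein.{w} W)).mapIso eX)
    ((toStable (gorenstein.{w} W)).mapIso eY) e ?_ ?_ ?_).symm⟩⟩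
  · exact ((toStable (gorenstein.{w} W)).map_comp ((cyclesZero W).map φ) eY.hom).symm.trans
      ((congrArg _ hφ').trans ((toStable (gorenstein.{w} W)).map_comp eX.hom f))
  · refine ((toStable (gorenstein.{w} W)).map_comp (Y := (cyclesZero W).obj (coneTac φ)) _ r).symm.trans
      ((congrArg _ ?_).trans ((toStable (gorenstein.{w} W)).map_comp eY.hom g))
    rw [← inl_coneConflation_g, Category.assoc, hr, ← Category.assoc, coneMidInl_fst,
      Category.id_comp]
  · refine (Category.assoc _ _ _).trans ((congrArg _ h₄.symm).trans ?_)
    refine (Category.assoc _ _ _).symm.trans (Eq.trans ?_ (Category.assoc _ _ _))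
    exact congrArg (· ≫ (suspIso hS').hom) ((Functor.map_comp _ _ _).symm.trans
      (hδ.symm.trans (Functor.map_comp _ _ _)))

section

variable [∀ n : ℤ, (shiftFunctor (StGor.{w} W) n).Additive] [Pretriangulated (StGor.{w} W)]
  [(stableCyclesZero.{w} W).IsTriangulated]

lemma stableConeTriangle_distinguished {K L : Tac.{w} W} (φ : K ⟶ L) :
    stableConeTriangle φ ∈ distTriang (StGor.{w} W) :=
  isomorphic_distinguished _ ((stableCyclesZero W).map_distinguished _
    (coneTriangle_distinguished φ)) _ (mapTriangleConeTriangleIso φ).symm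

/-- The triangulation of the stable category is the usual one. -/
noncomputable def standardTriangulation : StandardTriangulation (gorenstein.{w} W) where
  suspIso S hS hp hi := suspIso ⟨hS, hp, hi⟩
  suspIso_naturality S S' hS hp hi hS' hp' hi' φ := suspIso_naturality _ _ φ
  distinguished_iff T := by
    constructor
    · intro hT
      -- Since Z₀ is a triangulated equivalence, every distinguished triangle is the image of one in
      -- the homotopy category, hence of a cone triangle up to isomorphism.
      rw [(stableCyclesZero W).distTriang_iff] at hT
      obtain ⟨T', e, hT'⟩ := hT
      obtain ⟨K, L, φ, ⟨e'⟩⟩ := exists_iso_coneTriangle T' hT'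
      have hK := isCosyzygy_cyclesConflation K
      exact ⟨_, _, _, _, _, (coneConflation φ).f, (coneConflation φ).g, (cyclesConflation K).f,
        (cyclesConflation K).g, (coneConflation φ).zero, (cyclesConflation K).zero,
        -coneMidSnd K L, (cyclesZero W).map (coneTacDelta φ), isConflation_coneConflation φ,
        hK.isConflation, hK.isRelProjective, hK.isRelInjective,
        by rw [Preadditive.comp_neg, coneConflation_f_snd, neg_neg],
        by rw [coneConflation_g_delta, Preadditive.neg_comp],
        ⟨e ≪≫ (stableCyclesZero W).mapTriangle.mapIso e' ≪≫ mapTriangleConeTriangleIso φ ≪≫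
          (coneConflationTriangleIso φ).symm⟩⟩
    · rintro ⟨X, Y, Z, I, C, f, g, i, p, w, w', j, k, hS, hS', hp, hi, hj, hk, ⟨e⟩⟩
      obtain ⟨K, L, φ, ⟨e'⟩⟩ := nonempty_iso_stableConeTriangle hS ⟨hS', hp, hi⟩ hj hk
      exact isomorphic_distinguished _ (stableConeTriangle_distinguished φ) _ (e ≪≫ e')

end

end StandardTriangulation

/-! ### Transport of triangulated structures and adjunctions along an equivalence -/

section Transport

variable {C D : Type*} [Category* C] [Category* D]

lemma isCompatibleWithShift_isomorphisms [HasShift C ℤ] :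
    (MorphismProperty.isomorphisms C).IsCompatibleWithShift ℤ where
  condition n := by
    ext X Y f
    exact ⟨fun (h : IsIso _) => isIso_of_reflects_iso f (shiftFunctor C n),
      fun (h : IsIso f) => inferInstanceAs (IsIso ((shiftFunctor C n).map f))⟩

lemma hasLeftCalculusOfFractions_isomorphisms :
    (MorphismProperty.isomorphisms C).HasLeftCalculusOfFractions where
  exists_leftFraction X Y φ := by
    have : IsIso φ.s := φ.hs
    exact ⟨⟨inv φ.s ≫ φ.f, 𝟙 _, MorphismProperty.id_mem _ _⟩, by simp⟩
  ext X' X Y f₁ f₂ s hs h := by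
    have : IsIso s := hs
    exact ⟨_, 𝟙 _, MorphismProperty.id_mem _ _, by rw [(cancel_epi s).1 h]⟩

lemma isCompatibleWithTriangulation_isomorphisms [HasZeroObject C] [Preadditive C] [HasShift C ℤ]
    [∀ n : ℤ, (shiftFunctor C n).Additive] [Pretriangulated C] :
    (MorphismProperty.isomorphisms C).IsCompatibleWithTriangulation where
  toIsCompatibleWithShift := isCompatibleWithShift_isomorphisms
  compatible_with_triangulation T₁ T₂ hT₁ hT₂ a b ha hb h := by
    have : IsIso a := ha
    have : IsIso b := hb
    let φ := completeDistinguishedTriangleMorphism T₁ T₂ hT₁ hT₂ a b h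
    exact ⟨φ.hom₃, isIso₃_of_isIso₁₂ φ hT₁ hT₂ ha hb, φ.comm₂, φ.comm₃⟩

/-- A triangulated structure can be transported along an equivalence. -/
lemma exists_triangulated_of_isEquivalence [HasZeroObject C] [Preadditive C] [HasShift C ℤ]
    [∀ n : ℤ, (shiftFunctor C n).Additive] [Pretriangulated C] [IsTriangulated C]
    [HasZeroObject D] [Preadditive D] (F : C ⥤ D) [F.IsEquivalence] [F.Additive] :
    ∃ (_ : HasShift D ℤ) (_ : ∀ n : ℤ, (shiftFunctor D n).Additive) (_ : Pretriangulated D)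
      (_ : IsTriangulated D) (_ : F.CommShift ℤ), F.IsTriangulated := by
  -- An equivalence is a localization at the isomorphisms, so the shift and the triangulation on D
  -- are obtained as those of a localized category.
  have h₁ : F.IsLocalization (MorphismProperty.isomorphisms C) :=
    Functor.IsLocalization.of_isEquivalence _ _ le_rfl
  have h₂ := isCompatibleWithTriangulation_isomorphisms (C := C)
  have h₃ := hasLeftCalculusOfFractions_isomorphisms (C := C)
  let s : HasShift D ℤ := HasShift.localized F (MorphismProperty.isomorphisms C) ℤ
  let c : F.CommShift ℤ := Functor.CommShift.localized F (MorphismProperty.isomorphisms C) ℤ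
  have h₄ : ∀ n : ℤ, (shiftFunctor D n).Additive := fun n => by
    rw [Localization.functor_additive_iff F (MorphismProperty.isomorphisms C)]
    exact Functor.additive_of_iso (F.commShiftIso n)
  let p : Pretriangulated D :=
    Triangulated.Localization.pretriangulated F (MorphismProperty.isomorphisms C)
  have h₅ : F.IsTriangulated :=
    Triangulated.Localization.isTriangulated_functor F (MorphismProperty.isomorphisms C)
  exact ⟨s, h₄, p,
    Triangulated.Localization.isTriangulated F (MorphismProperty.isomorphisms C), c, h₅⟩

/-- The inverse receives the shift compatibility that makes the equivalence compatible with shifts.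
It is then triangulated as a right adjoint of a triangulated functor, and reversing the equivalence
gives the other adjunction. -/
lemma exists_isTriangulated_adjunction_of_equivalence [HasZeroObject C] [Preadditive C]
    [HasShift C ℤ] [∀ n : ℤ, (shiftFunctor C n).Additive] [Pretriangulated C] [HasZeroObject D]
    [Preadditive D] [HasShift D ℤ] [∀ n : ℤ, (shiftFunctor D n).Additive] [Pretriangulated D]
    (E : C ≌ D) [E.functor.CommShift ℤ] [E.functor.IsTriangulated] :
    ∃ (_ : E.inverse.CommShift ℤ) (adj : E.inverse ⊣ E.functor) (adj' : E.functor ⊣ E.inverse),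
      adj.IsTriangulated ∧ adj'.IsTriangulated ∧ E.inverse.IsEquivalence := by
  let c := E.commShiftInverse ℤ
  have h₁ : E.CommShift ℤ := E.commShift_of_functor ℤ
  have h₂ : E.symm.CommShift ℤ := inferInstance
  have h₃ : E.toAdjunction.IsTriangulated := .mk' _
  have h₄ : E.inverse.IsTriangulated := h₃.rightAdjoint_isTriangulated
  exact ⟨c, E.symm.toAdjunction, E.toAdjunction,
    { commShift := h₂, leftAdjoint_isTriangulated := h₄,
      rightAdjoint_isTriangulated := inferInstanceAs E.functor.IsTriangulated }, h₃, inferInstance⟩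

lemma exists_isTriangulated_adjunction [HasZeroObject C] [Preadditive C]
    [HasShift C ℤ] [∀ n : ℤ, (shiftFunctor C n).Additive] [Pretriangulated C] [HasZeroObject D]
    [Preadditive D] [HasShift D ℤ] [∀ n : ℤ, (shiftFunctor D n).Additive] [Pretriangulated D]
    (F : C ⥤ D) [F.IsEquivalence] [hc : F.CommShift ℤ] [hF : F.IsTriangulated] {T : D ⥤ C}
    (e : T ⋙ F ≅ 𝟭 D) :
    ∃ (_ : T.CommShift ℤ) (adj : T ⊣ F) (adj' : F ⊣ T),
      adj.IsTriangulated ∧ adj'.IsTriangulated ∧ T.IsEquivalence := by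
  -- A one-sided inverse suffices: full faithfulness of F reflects `e` at `F.obj X` to the missing
  -- isomorphism.
  let e' : F ⋙ T ≅ 𝟭 C := NatIso.ofComponents (fun X => F.preimageIso (e.app (F.obj X)))
    fun f => F.map_injective (by simpa using e.hom.naturality (F.map f))
  exact @exists_isTriangulated_adjunction_of_equivalence _ _ _ _ _ _ _ _ _ _ _ _ _ _
    (CategoryTheory.Equivalence.mk F T e'.symm e) hc hF

end Transport

/-! ### The functor given by complete resolutions -/

section Lifts

variable {A : Type u} [Category.{v} A] [Abelian A] [HasExt.{w} A] {W : ObjectProperty A}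
  [IsSelfOrthogonal.{w} W] [W.ContainsZero] [W.IsClosedUnderIsomorphisms]
  [W.IsClosedUnderBinaryProducts] (R : CompleteResolutions.{w} W)

/-- The identification of the cycles of the chosen complex, in the stable category. -/
noncomputable def stableCyclesIso (X : StGor.{w} W) :
    (stableCyclesZero W).obj ((toKTac W).obj (R.complex X.as)) ≅ X :=
  (toStable (gorenstein.{w} W)).mapIso (R.cyclesIso X.as)

/-- The functor given by a choice of complete resolutions. -/
noncomputable def liftFunctor : StGor.{w} W ⥤ KTac.{w} W where
  obj X := (toKTac W).obj (R.complex X.as)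
  -- Morphisms are defined through full faithfulness of Z₀, so functoriality can be checked after
  -- applying Z₀.
  map {X Y} f := (stableCyclesZero W).preimage
    ((stableCyclesIso R X).hom ≫ f ≫ (stableCyclesIso R Y).inv)
  map_id X := by
    apply (stableCyclesZero W).map_injective
    rw [Functor.map_preimage, Category.id_comp, Iso.hom_inv_id]
    exact ((stableCyclesZero W).map_id _).symm
  map_comp f g := by
    apply (stableCyclesZero W).map_injective
    rw [Functor.map_preimage, Functor.map_comp, Functor.map_preimage, Functor.map_preimage]
    simp

lemma stableCyclesZero_map_liftFunctor_map {X Y : StGor.{w} W} (f : X ⟶ Y) :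
    (stableCyclesZero W).map ((liftFunctor R).map f) =
      (stableCyclesIso R X).hom ≫ f ≫ (stableCyclesIso R Y).inv :=
  (stableCyclesZero W).map_preimage _

/-- Any lift of f has the same image under the faithful functor Z₀ as the morphism defining the
functor, so its homotopy class is that morphism. -/
lemma isInducedByLifts_liftFunctor : IsInducedByLifts R (liftFunctor R) := by
  refine ⟨fun M => rfl, fun M M' f φ h => ?_⟩
  refine Eq.trans ?_ ((Category.id_comp _).trans (Category.comp_id _)).symm
  apply (stableCyclesZero W).map_injective
  refine (stableCyclesZero_map_liftFunctor_map R _).trans ?_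
  have h' := congrArg (toStable (gorenstein.{w} W)).map h
  rw [Functor.map_comp, Functor.map_comp] at h'
  refine (Category.assoc _ _ _).symm.trans ((Iso.comp_inv_eq (stableCyclesIso R _)).2 h'.symm)

/-- The functor `Z₀` is inverse to the functor given by a choice of complete resolutions. -/
noncomputable def liftFunctorCompIso : liftFunctor R ⋙ stableCyclesZero W ≅ 𝟭 (StGor.{w} W) :=
  NatIso.ofComponents (stableCyclesIso R) fun {X Y} f => by
    refine (congrArg (· ≫ _) (stableCyclesZero_map_liftFunctor_map R f)).trans ?_
    exact (Category.assoc _ _ _).trans (congrArg _ (((Category.assoc _ _ _).trans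
      (congrArg _ (Iso.inv_hom_id _))).trans (Category.comp_id _)))

lemma exists_triangulated_adjunctions [HasShift (StGor.{w} W) ℤ]
    [∀ n : ℤ, (shiftFunctor (StGor.{w} W) n).Additive] [Pretriangulated (StGor.{w} W)]
    [(stableCyclesZero.{w} W).CommShift ℤ] [(stableCyclesZero.{w} W).IsTriangulated] :
    ∃ (T : StGor.{w} W ⥤ KTac.{w} W) (_ : T.CommShift ℤ) (adj : T ⊣ stableCyclesZero.{w} W)
      (adj' : stableCyclesZero.{w} W ⊣ T), IsInducedByLifts R T ∧ adj.IsTriangulated ∧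
        adj'.IsTriangulated ∧ T.IsEquivalence ∧ (stableCyclesZero.{w} W).IsEquivalence := by
  obtain ⟨c, adj, adj', h, h', h''⟩ :=
    exists_isTriangulated_adjunction (stableCyclesZero.{w} W) (liftFunctorCompIso R)
  exact ⟨liftFunctor R, c, adj, adj', isInducedByLifts_liftFunctor R, h, h', h'', inferInstance⟩

end Lifts

/-! ### Gorenstein injective and Gorenstein projective objects -/

section ClassicalComplexes

variable {A : Type u} [Category.{v} A] [Abelian A]

/-- A cocycle factors through the cycles of the next degree, and injectivity of I extends the factor
along the inclusion of these cycles. -/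
lemma homToAcyclic_of_injective {T : CochainComplex A ℤ} (hT : T.Acyclic) (I : A) [Injective I] :
    HomToAcyclic T I := by
  rw [homToAcyclic_iff]
  intro i j k hi hk f hf
  have := epi_toCycles hT i j hi
  obtain ⟨g, hg⟩ := exists_toCycles_comp hT j k hk f (by
    rw [← cancel_epi (T.toCycles i j), ← Category.assoc, T.toCycles_i, hf, comp_zero])
  exact ⟨Injective.factorThru g (T.iCycles k), by
    rw [← T.toCycles_i, Category.assoc, Injective.comp_factorThru, hg]⟩

lemma homFromAcyclic_of_projective {T : CochainComplex A ℤ} (hT : T.Acyclic) (P : A)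
    [Projective P] : HomFromAcyclic P T := by
  rw [homFromAcyclic_iff]
  intro i j k hi hk f hf
  have := epi_toCycles hT i j hi
  exact ⟨Projective.factorThru (T.liftCycles f k (by simp [hk]) hf) (T.toCycles i j), by
    rw [← T.toCycles_i, ← Category.assoc, Projective.factorThru_comp, T.liftCycles_i]⟩

variable [HasExt.{w} A]

/-- Extending a map along a monomorphism is obstructed only by Ext¹ of its cokernel. -/
lemma injective_of_subsingleton_ext {I : A} (h : ∀ M : A, Subsingleton (Abelian.Ext.{w} M I 1)) :
    Injective I where
  factors g f _ := exists_extension_of_ext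
    (S := ShortComplex.mk f (cokernel.π f) (cokernel.condition f))
    { exact := ShortComplex.exact_cokernel f } (h _) g

lemma projective_of_subsingleton_ext {P : A} (h : ∀ N : A, Subsingleton (Abelian.Ext.{w} P N 1)) :
    Projective P where
  factors f e _ := exists_lift_of_ext
    (S := ShortComplex.mk (kernel.ι e) e (kernel.condition e))
    { exact := ShortComplex.exact_kernel e } (h _) f

lemma isCotorsionPair_top_isInjective :
    IsCotorsionPair.{w} (⊤ : ObjectProperty A) (isInjective A) where
  rightPerp_eq := by
    ext I
    refine ⟨fun h => injective_of_subsingleton_ext.{w} fun M => h M trivial,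
      fun (h : Injective I) M _ => Abelian.Ext.subsingleton_of_injective _ _ _⟩
  leftPerp_eq := by
    ext M
    exact ⟨fun _ => trivial,
      fun _ I (h : Injective I) => Abelian.Ext.subsingleton_of_injective _ _ _⟩

lemma isCotorsionPair_isProjective_top :
    IsCotorsionPair.{w} (isProjective A) (⊤ : ObjectProperty A) where
  rightPerp_eq := by
    ext N
    exact ⟨fun _ => trivial,
      fun _ P (h : Projective P) => Abelian.Ext.subsingleton_of_projective _ _ _⟩
  leftPerp_eq := by
    ext P
    refine ⟨fun h => projective_of_subsingleton_ext.{w} fun N => h N trivial,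
      fun (h : Projective P) N _ => Abelian.Ext.subsingleton_of_projective _ _ _⟩

/-- In the symmetric characterisation the condition on Hom(T, I) is automatic for injective I, which
leaves the condition on Hom(I, T). -/
lemma totallyAcyclic_isInjective :
    totallyAcyclic.{w} (⊤ ⊓ isInjective A) = totallyAcyclicInjective := by
  have := isCotorsionPair_top_isInjective.{w} (A := A)
  have := isSelfOrthogonal_inf.{w} (⊤ : ObjectProperty A) (isInjective A)
  rw [top_inf_eq] at this ⊢
  ext T
  refine (isTotallyAcyclic_iff T).trans (and_congr_right fun hT => and_congr Iff.rfl
    ⟨fun h I hI => (h I hI).1, fun h I (hI : Injective I) =>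
      ⟨h I hI, homToAcyclic_of_injective hT I⟩⟩)

/-- Here the condition on Hom(P, T) is the automatic one, which leaves the condition on Hom(T, P).
-/
lemma totallyAcyclic_isProjective :
    totallyAcyclic.{w} (isProjective A ⊓ ⊤) = totallyAcyclicProjective := by
  have := isCotorsionPair_isProjective_top.{w} (A := A)
  have := isSelfOrthogonal_inf.{w} (isProjective A) (⊤ : ObjectProperty A)
  rw [inf_top_eq] at this ⊢
  ext T
  refine (isTotallyAcyclic_iff T).trans (and_congr_right fun hT => and_congr Iff.rfl
    ⟨fun h P hP => (h P hP).2, fun h P (hP : Projective P) =>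
      ⟨homFromAcyclic_of_projective hT P, h P hP⟩⟩)

lemma gorenstein_isInjective :
    gorenstein.{w} (⊤ ⊓ isInjective A) = gorensteinInjective := by
  ext M
  exact exists_congr fun T => and_congr
    (iff_of_eq (congrFun totallyAcyclic_isInjective.{w} T)) Iff.rfl

lemma gorenstein_isProjective :
    gorenstein.{w} (isProjective A ⊓ ⊤) = gorensteinProjective := by
  ext M
  exact exists_congr fun T => and_congr
    (iff_of_eq (congrFun totallyAcyclic_isProjective.{w} T)) Iff.rfl

end ClassicalComplexes

end GorensteinStable

theorem corollary3p8 {A : Type u} [Category.{v} A] [Abelian A] [HasExt.{w} A] :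
    (∀ (U V : ObjectProperty A) [IsCotorsionPair.{w} U V],
      IsFrobenius (gorenstein.{w} (U ⊓ V)) ∧
      ∃ (_ : (homotopyTotallyAcyclic.{w} (U ⊓ V)).IsTriangulated)
        (_ : HasShift (StGor.{w} (U ⊓ V)) ℤ)
        (_ : ∀ n : ℤ, (shiftFunctor (StGor.{w} (U ⊓ V)) n).Additive)
        (_ : Pretriangulated (StGor.{w} (U ⊓ V)))
        (_ : IsTriangulated (StGor.{w} (U ⊓ V)))
        (_ : StandardTriangulation (gorenstein.{w} (U ⊓ V)))
        (_ : (stableCyclesZero.{w} (U ⊓ V)).CommShift ℤ),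
        ∀ R : CompleteResolutions.{w} (U ⊓ V),
          ∃ (T : StGor.{w} (U ⊓ V) ⥤ KTac.{w} (U ⊓ V)) (_ : T.CommShift ℤ)
            (adj : T ⊣ stableCyclesZero.{w} (U ⊓ V))
            (adj' : stableCyclesZero.{w} (U ⊓ V) ⊣ T),
            IsInducedByLifts R T ∧ adj.IsTriangulated ∧ adj'.IsTriangulated ∧
              T.IsEquivalence ∧ (stableCyclesZero.{w} (U ⊓ V)).IsEquivalence) ∧
    (IsCotorsionPair.{w} (⊤ : ObjectProperty A) (isInjective A) ∧
      totallyAcyclic.{w} (⊤ ⊓ isInjective A) = totallyAcyclicInjective ∧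
      gorenstein.{w} (⊤ ⊓ isInjective A) = gorensteinInjective) ∧
    (IsCotorsionPair.{w} (isProjective A) (⊤ : ObjectProperty A) ∧
      totallyAcyclic.{w} (isProjective A ⊓ ⊤) = totallyAcyclicProjective ∧
      gorenstein.{w} (isProjective A ⊓ ⊤) = gorensteinProjective) := by
  refine ⟨fun U V hUV => ?_, ⟨isCotorsionPair_top_isInjective, totallyAcyclic_isInjective,
    gorenstein_isInjective⟩, isCotorsionPair_isProjective_top, totallyAcyclic_isProjective,
    gorenstein_isProjective⟩
  have h₁ := isSelfOrthogonal_inf.{w} U V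
  have h₂ := containsZero_inf.{w} U V
  have h₃ := isClosedUnderIsomorphisms_inf.{w} U V
  have h₄ := isClosedUnderBinaryProducts_inf.{w} U V
  -- The stable category receives its shift and triangulation from the homotopy category. That this
  -- is the usual triangulation is then a property of the transported structure.
  obtain ⟨s, hs, p, hp, c, hc⟩ :=
    exists_triangulated_of_isEquivalence (stableCyclesZero.{w} (U ⊓ V))
  exact ⟨isFrobenius_gorenstein, inferInstance, s, hs, p, hp, standardTriangulation, c,
    fun R => exists_triangulated_adjunctions R⟩
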